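/- Let $\mathbb H$ be the real quaternions, and for a quaternion matrix $M$ let $M^*$ be its conjugate transpose, $\mathcal C_r(M)=\{Mx\}$ its right column space and $\operatorname{rk}M=\dim\mathcal C_r(M)$ its rank. For square $M$, the index $\operatorname{Ind}M$ is the smallest positive integer $k$ with $\operatorname{rk}M^{k+1}=\operatorname{rk}M^{k}$. $M^\dagger$ denotes the Moore–Penrose inverse, the unique $X$ with $MXM=M$, $XMX=X$, $(MX)^*=MX$, $(XM)^*=XM$. Row determinants. For $M=(m_{ij})$ a square matrix whose rows and columns are indexed by a finite linearly ordered set $\alpha$, and $i\in\alpha$, put $$\operatorname{rdet}_i M=\sum_{\sigma}(-1)^{|\alpha|-r}\,(m_{i\,i_{1}}m_{i_1 i_2}\cdots m_{i_{l}\,i})(m_{a_2\,\sigma(a_2)}\cdots m_{\sigma^{-1}(a_2)\,a_2})\cdots(m_{a_r\,\sigma(a_r)}\cdots m_{\sigma^{-1}(a_r)\,a_r}),$$ where $\sigma$ runs over all permutations of $\alpha$, $r$ is the number of its cycles (fixed points included), the first cycle $(i\ i_1\ \cdots\ i_l)$ is written starting from $i$, every other cycle is written starting from its minimal element $a_t$,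 and $a_2<\cdots<a_r$. For Hermitian $M$ all row determinants coincide, and $\det M$ is their common value (equal to $1$ if $\alpha=\varnothing$). For an $n\times n$ matrix $M$ and $\alpha\subseteq\{1,\dots,n\}$ let $(M)_\alpha^\alpha$ be the principal submatrix with rows and columns in $\alpha$, and, for Hermitian $M$, $|M|_\alpha^\alpha=\det (M)_\alpha^\alpha$. Let $M_{j.}(b)$ be $M$ with its $j$-th row replaced by the row $b$. Let $I_{s,n}$ be the set of $s$-element subsets of $\{1,\dots,n\}$ and $I_{s,n}\{j\}=\{\alpha\in I_{s,n}: j\in\alpha\}$. **Theorem.** Let $A\in\mathbb H^{m\times n}$, $W\in\mathbb H^{n\times m}$, $k=\max\{\operatorname{Ind}(WA),\operatorname{Ind}(AW)\}$, $U=WA$ and $s=\operatorname{rk}U^k$. The right $W$-weighted core-EP inverse $A^{\dagger,W,r}=(a_{ij})\in\mathbb H^{m\times n}$ of $A$, i.e. the solution $X$ of $$WAWX=(WA)^k\big[(WA)^k\big]^\dagger,\qquad \mathcal C_r(X)\subseteq\mathcal C_r\big((AW)^k\big),$$ exists and is unique, and for all $1\le i\le m$, $1\le j\le n$ $$a_{ij}=\frac{\displaystyle\sum_{\alpha\in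 I_{s,n}\{j\}}\operatorname{rdet}_j\Big(\big(U^{k+1}(U^{k+1})^*\big)_{j.}(\widetilde\phi_{i.})\Big)_\alpha^\alpha}{\Big(\displaystyle\sum_{\alpha\in I_{s,n}}\big|U^{k+1}(U^{k+1})^*\big|_\alpha^\alpha\Big)^2},$$ with nonzero denominator. Here $\widetilde\phi_{i.}$ is the $i$-th row of $\widetilde\Phi=\Phi\,U^k(U^{k+1})^*$, and $\Phi=(\phi_{if})\in\mathbb H^{m\times n}$ is given by $$\phi_{if}=\sum_{\alpha\in I_{s,n}\{f\}}\operatorname{rdet}_f\Big(\big(U^{k+1}(U^{k+1})^*\big)_{f.}(\widetilde u_{i.})\Big)_\alpha^\alpha,$$ where $\widetilde u_{i.}$ is the $i$-th row of $\widetilde U=A\,U^k(U^{k+1})^*$. -/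

import Mathlib

open scoped Quaternion

namespace QuaternionMatrix

section RowDeterminant

variable {ι R : Type*} [Fintype ι] [LinearOrder ι] [Ring R]

/-- The product `a_{x, σ x} a_{σ x, σ² x} ⋯ a_{σˡ x, x}` of the entries of `A` along the cycle of `σ`
that contains `x`, written starting from `x` (for a fixed point `x` this is `a_{x, x}`). -/
noncomputable def cycleProd (A : Matrix ι ι R) (σ : Equiv.Perm ι) (x : ι) : R :=
  ((List.range (Function.minimalPeriod σ x)).map
    fun t => A ((σ ^ t) x) ((σ ^ (t + 1)) x)).prod

/-- The minimal elements of the cycles of `σ` (fixed points included)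
other than the cycle through `i`. -/
def otherLeaders (σ : Equiv.Perm ι) (i : ι) : Finset ι :=
  Finset.univ.filter fun x => ¬ σ.SameCycle i x ∧ ∀ y, σ.SameCycle x y → x ≤ y

/-- The `i`-th row determinant `rdet_i A`: the signed sum over all permutations of the products of
the entries of `A` along the cycles, where the first cycle starts with `i`, every other cycle starts
with its minimal element, and these other cycles are ordered increasingly by their first elements.
(The sign of a permutation of `n` elements with `r` cycles, fixed points included,
is `(-1) ^ (n - r)`.) -/
noncomputable def rdet (A : Matrix ι ι R) (i : ι) : R :=
  ∑ σ : Equiv.Perm ι, Equiv.Perm.sign σ •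
    (cycleProd A σ i * (((otherLeaders σ i).sort (· ≤ ·)).map (cycleProd A σ)).prod)

open Classical in
/-- The determinant of a Hermitian matrix. All the row determinants of a Hermitian quaternion matrix
coincide, and the determinant is their common value; here it is read off from the first row.
The determinant of the empty matrix is `1`. -/
noncomputable def hdet (A : Matrix ι ι R) : R :=
  if h : (Finset.univ : Finset ι).Nonempty then rdet A (Finset.univ.min' h) else 1

end RowDeterminant

section Minors

variable {n : ℕ}

/-- The principal submatrix of `M` with rows and columns indexed by `α`. -/
def principalSub (M : Matrix (Fin n) (Fin n) ℍ[ℝ]) (α : Finset (Fin n)) : Matrix α α ℍ[ℝ] :=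
  M.submatrix (fun x => (x : Fin n)) (fun x => (x : Fin n))

/-- `∑_{α ∈ I_{s,n}} |M|_α^α`, the sum of all principal minors of order `s` of a Hermitian `M`. -/
noncomputable def sumMinors (s : ℕ) (M : Matrix (Fin n) (Fin n) ℍ[ℝ]) : ℍ[ℝ] :=
  ∑ α : {α : Finset (Fin n) // α.card = s}, hdet (principalSub M α.1)

/-- `∑_{α ∈ I_{s,n}{j}} rdet_j (M_{j.}(b))_α^α`: the row `j` of `M` is replaced by `b`, and the sum
runs over the `s`-element index sets `α` that contain `j`. -/
noncomputable def sumRdet (s : ℕ) (M : Matrix (Fin n) (Fin n) ℍ[ℝ]) (j : Fin n)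
    (b : Fin n → ℍ[ℝ]) : ℍ[ℝ] :=
  ∑ α : {α : Finset (Fin n) // α.card = s ∧ j ∈ α},
    rdet (principalSub (M.updateRow j b) α.1) ⟨j, α.2.2⟩

end Minors

/-- The right column space `C_r(A) = {A x}`, a right vector space over the quaternions. -/
def colSpace {m n : ℕ} (A : Matrix (Fin m) (Fin n) ℍ[ℝ]) : Submodule ℍ[ℝ]ᵐᵒᵖ (Fin m → ℍ[ℝ]) where
  carrier := {y | ∃ x : Fin n → ℍ[ℝ], y = A.mulVec x}
  add_mem' := by
    rintro _ _ ⟨x, rfl⟩ ⟨y, rfl⟩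
    exact ⟨x + y, (Matrix.mulVec_add A x y).symm⟩
  zero_mem' := ⟨0, (Matrix.mulVec_zero A).symm⟩
  smul_mem' := by
    rintro c _ ⟨x, rfl⟩
    exact ⟨c • x, (Matrix.mulVec_smul A c x).symm⟩

/-- The rank of a quaternion matrix: the dimension of its right column space. -/
noncomputable def rk {m n : ℕ} (A : Matrix (Fin m) (Fin n) ℍ[ℝ]) : ℕ :=
  Module.finrank ℍ[ℝ]ᵐᵒᵖ (colSpace A)

/-- The index of a square matrix: the least positive `k` with `rk (A ^ (k + 1)) = rk (A ^ k)`. -/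
noncomputable def ind {n : ℕ} (A : Matrix (Fin n) (Fin n) ℍ[ℝ]) : ℕ :=
  sInf {k : ℕ | 0 < k ∧ rk (A ^ (k + 1)) = rk (A ^ k)}

/-- `X` is the Moore-Penrose inverse of `A` (the four Penrose equations). -/
structure IsMoorePenrose {m n : ℕ} (A : Matrix (Fin m) (Fin n) ℍ[ℝ])
    (X : Matrix (Fin n) (Fin m) ℍ[ℝ]) : Prop where
  mul_mul_self : A * X * A = A
  self_mul_mul : X * A * X = X
  left_herm : (A * X).conjTranspose = A * X
  right_herm : (X * A).conjTranspose = X * A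

/-- `X` solves the system that defines the right `W`-weighted core-EP inverse of `A`: with
`k = max (Ind (W A)) (Ind (A W))`, `W A W X = (W A)^k ((W A)^k)†` and `C_r(X) ⊆ C_r((A W)^k)`. -/
def IsRightWeightedCoreEP {m n : ℕ} (A : Matrix (Fin m) (Fin n) ℍ[ℝ])
    (W : Matrix (Fin n) (Fin m) ℍ[ℝ]) (X : Matrix (Fin m) (Fin n) ℍ[ℝ]) : Prop :=
  (∃ P : Matrix (Fin n) (Fin n) ℍ[ℝ],
      IsMoorePenrose ((W * A) ^ max (ind (W * A)) (ind (A * W))) P ∧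
      W * A * W * X = (W * A) ^ max (ind (W * A)) (ind (A * W)) * P) ∧
    colSpace X ≤ colSpace ((A * W) ^ max (ind (W * A)) (ind (A * W)))

end QuaternionMatrix

set_option linter.unusedSectionVars false

/-! Everything reduces to a noncommutative adjugate calculus for a Hermitian matrix `G`. Since `b ↦
sumRdet r G f b` is left linear, it is given by a matrix `cofactorSum r G`, written C_r, and with
d_r = `minorSum r G` one has the Faddeev–LeVerrier recursion G C_r + C_{r+1} = d_r · 1
(`mul_cofactorSum_add`). Its combinatorial input is that row determinants of a Hermitian matrix
agree and are real (`hdetOn_spec`), and vanish when one row is overwritten by another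
(`rdetOn_updateRow_row_eq_zero`). Both come from writing a row determinant as a signed sum over
paths through the distinguished index, each weighted by a leftover principal minor.

Let G = N N* and let t be the last order with d_t ≠ 0. The recursion, run downwards from orders
beyond n, gives G C_{t+1} = 0, so E = d_t⁻¹ G C_t is a Hermitian idempotent with E N = N. The real
trace of E is t on one side and its rank on the other, so t = rk N, and d_t⁻¹ N* C_t is the
Moore–Penrose inverse of N (`isMoorePenrose_cofactorSum`).

For N = U^(k+1) with Moore–Penrose inverse T, the weighted core-EP inverse is A U^k T U^k T
(`isRightWeightedCoreEP_of_isMoorePenrose`). Each T is produced by one multiplication by N* C_s,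
which costs a factor d_s. Hence the two nested determinantal sums and the squared denominator. -/

namespace QuaternionMatrix

/-! ### Cycles of permutations and the expansion of a row determinant -/

section Perm

variable {ι κ R : Type*} [Fintype ι] [LinearOrder ι] [Fintype κ] [LinearOrder κ] [Ring R]

/-- The minimal elements of the cycles of `σ`. -/
def leaders (σ : Equiv.Perm ι) : Finset ι :=
  Finset.univ.filter fun x => ∀ y, σ.SameCycle x y → x ≤ y

theorem mem_leaders {σ : Equiv.Perm ι} {x : ι} :
    x ∈ leaders σ ↔ ∀ y, σ.SameCycle x y → x ≤ y := by
  simp [leaders]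

theorem mem_otherLeaders {σ : Equiv.Perm ι} {i x : ι} :
    x ∈ otherLeaders σ i ↔ ¬ σ.SameCycle i x ∧ ∀ y, σ.SameCycle x y → x ≤ y := by
  simp [otherLeaders]

theorem leaders_eq_insert {σ : Equiv.Perm ι} {i : ι} (hi : ∀ y, i ≤ y) :
    leaders σ = insert i (otherLeaders σ i) := by
  ext x
  simp only [mem_leaders, Finset.mem_insert, mem_otherLeaders]
  constructor
  · intro h
    by_cases hs : σ.SameCycle i x
    · exact Or.inl (le_antisymm (h i hs.symm) (hi x))
    · exact Or.inr ⟨hs, h⟩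
  · rintro (rfl | h)
    · exact fun y _ => hi y
    · exact h.2

/-- The least index leads its own cycle and sorts first, so no cycle is distinguished. In this form
the determinant can be recognised as what remains after a cycle is removed. -/
theorem hdet_eq_sum_leaders (A : Matrix ι ι R) :
    hdet A = ∑ σ : Equiv.Perm ι, Equiv.Perm.sign σ •
      (((leaders σ).sort (· ≤ ·)).map (cycleProd A σ)).prod := by
  unfold hdet
  split_ifs with h
  · unfold rdet
    refine Finset.sum_congr rfl fun σ _ => ?_
    have hi : ∀ y, Finset.univ.min' h ≤ y := fun y => Finset.min'_le _ _ (Finset.mem_univ y)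
    rw [leaders_eq_insert hi, Finset.sort_insert (· ≤ ·) (fun b _ => hi b), List.map_cons, List.prod_cons]
    exact fun h => (mem_otherLeaders.1 h).1 (Equiv.Perm.SameCycle.refl _ _)
  · have : IsEmpty ι := by
      rw [Finset.not_nonempty_iff_eq_empty, Finset.univ_eq_empty_iff] at h
      exact h
    have hl : ∀ σ : Equiv.Perm ι, leaders σ = ∅ := fun σ => Finset.eq_empty_of_isEmpty _
    simp [hl]

theorem pow_apply_comm_of_sameCycle {σ : Equiv.Perm ι} {τ : Equiv.Perm κ} {g : κ → ι} {x : κ}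
    (h : ∀ y, τ.SameCycle x y → σ (g y) = g (τ y)) (t : ℕ) :
    (σ ^ t) (g x) = g ((τ ^ t) x) := by
  induction t with
  | zero => rfl
  | succ t ih =>
    rw [pow_succ', pow_succ', Equiv.Perm.mul_apply, Equiv.Perm.mul_apply, ih]
    exact h _ ⟨t, by simp⟩

theorem cycleProd_apply_eq {σ : Equiv.Perm ι} {τ : Equiv.Perm κ} {g : κ → ι}
    (hg : Function.Injective g) {x : κ} {A : Matrix ι ι R} {B : Matrix κ κ R}
    (h : ∀ y, τ.SameCycle x y → σ (g y) = g (τ y))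
    (hAB : ∀ y, τ.SameCycle x y → A (g y) (g (τ y)) = B y (τ y)) :
    cycleProd A σ (g x) = cycleProd B τ x := by
  have hp := pow_apply_comm_of_sameCycle h
  have hm : Function.minimalPeriod σ (g x) = Function.minimalPeriod τ x := by
    have key : ∀ t, Function.IsPeriodicPt σ t (g x) ↔ Function.IsPeriodicPt τ t x := by
      intro t
      simp only [Function.IsPeriodicPt, Function.IsFixedPt, Equiv.Perm.iterate_eq_pow, hp,
        hg.eq_iff]
    exact Nat.dvd_antisymm (((key _).2 (Function.isPeriodicPt_minimalPeriod _ _)).minimalPeriod_dvd)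
      (((key _).1 (Function.isPeriodicPt_minimalPeriod _ _)).minimalPeriod_dvd)
  unfold cycleProd
  rw [hm]
  congr 1
  refine List.map_congr_left fun t _ => ?_
  rw [hp, hp, pow_succ', Equiv.Perm.mul_apply]
  exact hAB _ ⟨t, by simp⟩

theorem cycleProd_of_fixed {σ : Equiv.Perm ι} {f : ι} (A : Matrix ι ι R) (h : σ f = f) :
    cycleProd A σ f = A f f := by
  have : Function.minimalPeriod σ f = 1 := Function.minimalPeriod_eq_one_iff_isFixedPt.2 h
  simp [cycleProd, this, h]

theorem pow_succ_apply_of_insert {σ : Equiv.Perm ι} {τ : Equiv.Perm κ} {g : κ → ι} {f : ι} {j : κ}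
    (hf : σ f = g j) (hσ : ∀ x, τ x ≠ j → σ (g x) = g (τ x)) {t : ℕ}
    (ht : t < Function.minimalPeriod τ j) : (σ ^ (t + 1)) f = g ((τ ^ t) j) := by
  induction t with
  | zero => simpa using hf
  | succ t ih =>
    rw [pow_succ', Equiv.Perm.mul_apply, ih (by omega), pow_succ' τ, Equiv.Perm.mul_apply]
    refine hσ _ fun hj => ?_
    have : Function.IsPeriodicPt τ (t + 1) j := by
      rw [Function.IsPeriodicPt, Function.IsFixedPt, Equiv.Perm.iterate_eq_pow, pow_succ']
      exact hj
    exact absurd (this.minimalPeriod_le (by omega)) (by omega)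

/-- Here `σ` is `τ` with `f` inserted just before `j`. The step of `τ` that returns to `j` now
returns to `f`, which is why column `j` is overwritten by column `f`. -/
theorem cycleProd_insert {σ : Equiv.Perm ι} {τ : Equiv.Perm κ} {g : κ → ι} {f : ι} {j : κ}
    (hgf : ∀ x, g x ≠ f) (hf : σ f = g j) (hσ : ∀ x, τ x ≠ j → σ (g x) = g (τ x))
    (hσ' : ∀ x, τ x = j → σ (g x) = f) (A : Matrix ι ι R) :
    cycleProd A σ f = A f (g j) *
      cycleProd ((A.submatrix g g).updateCol j fun x => A (g x) f) τ j := by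
  have hp := fun t => pow_succ_apply_of_insert (t := t) hf hσ
  have hpos : 0 < Function.minimalPeriod τ j :=
    Function.minimalPeriod_pos_of_mem_periodicPts
      ((Function.Injective.mem_periodicPts τ.injective) j)
  obtain ⟨p, hpp⟩ : ∃ p, Function.minimalPeriod τ j = p + 1 := ⟨_, (Nat.sub_add_cancel hpos).symm⟩
  have hper : (τ ^ (p + 1)) j = j := by
    have := Function.isPeriodicPt_minimalPeriod τ j
    rwa [hpp, Function.IsPeriodicPt, Function.IsFixedPt, Equiv.Perm.iterate_eq_pow] at this
  have hlast : (σ ^ (p + 1 + 1)) f = f := by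
    rw [pow_succ', Equiv.Perm.mul_apply, hp p (by omega)]
    apply hσ'
    rwa [← Equiv.Perm.mul_apply, ← pow_succ']
  have hm : Function.minimalPeriod σ f = p + 1 + 1 := by
    apply le_antisymm
    · refine Function.IsPeriodicPt.minimalPeriod_le (by omega) ?_
      rwa [Function.IsPeriodicPt, Function.IsFixedPt, Equiv.Perm.iterate_eq_pow]
    · by_contra hlt
      push Not at hlt
      have h1 : 0 < Function.minimalPeriod σ f :=
        Function.minimalPeriod_pos_of_mem_periodicPts
          ((Function.Injective.mem_periodicPts σ.injective) f)
      have h2 := Function.isPeriodicPt_minimalPeriod σ f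
      obtain ⟨q, hq⟩ : ∃ q, Function.minimalPeriod σ f = q + 1 := ⟨_, (Nat.sub_add_cancel h1).symm⟩
      rw [hq, Function.IsPeriodicPt, Function.IsFixedPt, Equiv.Perm.iterate_eq_pow,
        hp q (by omega)] at h2
      exact hgf _ h2
  unfold cycleProd
  rw [hm, hpp, List.range_succ_eq_map, List.map_cons, List.prod_cons, List.map_map]
  congr 1
  · simp [hf]
  · congr 1
    refine List.map_congr_left fun t ht => ?_
    rw [List.mem_range] at ht
    simp only [Function.comp, Nat.succ_eq_add_one]
    rw [hp t (by omega)]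
    by_cases htp : t = p
    · subst htp
      rw [hlast, hper, Matrix.updateCol_self]
    · rw [hp (t + 1) (by omega), Matrix.updateCol_ne]
      · rfl
      · intro hj
        have : Function.IsPeriodicPt τ (t + 1) j := by
          rwa [Function.IsPeriodicPt, Function.IsFixedPt, Equiv.Perm.iterate_eq_pow]
        exact absurd (this.minimalPeriod_le (by omega)) (by omega)

/-- `P` marks the points absorbed into the cycle of `f`. Away from them `g` carries cycles of `τ` to
cycles of `σ` and, being monotone, preserves their minima. -/
theorem otherLeaders_eq_map {σ : Equiv.Perm ι} {τ : Equiv.Perm κ} (g : κ ↪o ι) {f : ι}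
    (hg : ∀ y, y ≠ f → ∃ x, g x = y) {P : κ → Prop} [DecidablePred P]
    (hP : ∀ x, σ.SameCycle f (g x) ↔ P x)
    (h : ∀ x, ¬ P x → ∀ y, τ.SameCycle x y → σ (g y) = g (τ y)) :
    otherLeaders σ f = ((leaders τ).filter fun x => ¬ P x).map g.toEmbedding := by
  have key : ∀ x, ¬ P x → ∀ z, σ.SameCycle (g x) z ↔ ∃ y, g y = z ∧ τ.SameCycle x y := by
    intro x hx z
    constructor
    · intro hz
      obtain ⟨t, rfl⟩ := hz.exists_nat_pow_eq
      exact ⟨(τ ^ t) x, (pow_apply_comm_of_sameCycle (h x hx) t).symm, ⟨t, by simp⟩⟩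
    · rintro ⟨y, rfl, hy⟩
      obtain ⟨t, rfl⟩ := hy.exists_nat_pow_eq
      exact ⟨t, by simpa using pow_apply_comm_of_sameCycle (h x hx) t⟩
  ext z
  simp only [mem_otherLeaders, Finset.mem_map, Finset.mem_filter, mem_leaders,
    RelEmbedding.coe_toEmbedding]
  constructor
  · rintro ⟨h1, h2⟩
    obtain ⟨x, rfl⟩ := hg z (by rintro rfl; exact h1 (Equiv.Perm.SameCycle.refl _ _))
    rw [hP] at h1
    refine ⟨x, ⟨fun y hy => ?_, h1⟩, rfl⟩
    exact g.le_iff_le.1 (h2 _ ((key x h1 _).2 ⟨y, rfl, hy⟩))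
  · rintro ⟨x, ⟨h1, h2⟩, rfl⟩
    refine ⟨by rwa [hP], fun z hz => ?_⟩
    obtain ⟨y, rfl, hy⟩ := (key x h2 z).1 hz
    exact g.le_iff_le.2 (h1 y hy)

theorem prod_sort_map_eq (g : κ ↪o ι) (s : Finset κ) {u : ι → R} {v : κ → R}
    (h : ∀ x ∈ s, u (g x) = v x) :
    (((s.map g.toEmbedding).sort (· ≤ ·)).map u).prod = ((s.sort (· ≤ ·)).map v).prod := by
  have := Finset.map_sort (r := (· ≤ ·)) (r' := (· ≤ ·)) g.toEmbedding s
    (fun a _ b _ => (g.le_iff_le (a := a) (b := b)).symm)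
  rw [← this, List.map_map]
  congr 1
  refine List.map_congr_left fun x hx => h x (by simpa using hx)

/-- Expansion of the row determinant along the first step of the distinguished cycle. -/
theorem rdet_expand (e : Option κ ≃ ι) (he : ∀ a b, e (some a) ≤ e (some b) ↔ a ≤ b)
    (A : Matrix ι ι R) :
    rdet A (e none) = A (e none) (e none) *
        hdet (A.submatrix (fun x => e (some x)) (fun x => e (some x))) -
      ∑ j, A (e none) (e (some j)) *
        rdet ((A.submatrix (fun x => e (some x)) (fun x => e (some x))).updateCol j
          fun x => A (e (some x)) (e none)) j := by
  classical
  set f := e none with hfdef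
  let g : κ ↪o ι := ⟨⟨fun x => e (some x), fun a b h => by simpa using h⟩, he _ _⟩
  have hgx : ∀ x, g x = e (some x) := fun _ => rfl
  have hgf : ∀ x, g x ≠ f := fun x h => by simp [hgx, hfdef] at h
  have hg : ∀ y, y ≠ f → ∃ x, g x = y := by
    intro y hy
    obtain ⟨o, rfl⟩ := e.surjective y
    cases o with
    | none => exact absurd rfl hy
    | some x => exact ⟨x, rfl⟩
  -- A permutation is determined by the image of `f` and the permutation left after deleting `f`
  -- from its cycle. The sign flips exactly when `f` is not fixed.
  let Ψ : Option κ × Equiv.Perm κ ≃ Equiv.Perm ι :=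
    Equiv.Perm.decomposeOption.symm.trans e.permCongr
  have hsum : rdet A f = ∑ o : Option κ, ∑ τ : Equiv.Perm κ, Equiv.Perm.sign (Ψ (o, τ)) •
    (cycleProd A (Ψ (o, τ)) f *
      (((otherLeaders (Ψ (o, τ)) f).sort (· ≤ ·)).map (cycleProd A (Ψ (o, τ)))).prod) := by
    rw [← Fintype.sum_prod_type', rdet, ← Ψ.sum_comp]
  rw [hsum, Fintype.sum_option, sub_eq_add_neg, ← Finset.sum_neg_distrib]
  congr 1
  · rw [hdet_eq_sum_leaders, Finset.mul_sum]
    refine Finset.sum_congr rfl fun τ _ => ?_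
    set σ := Ψ (none, τ) with hσdef
    have h1 : σ f = f := by simp [hσdef, Ψ, hfdef, Equiv.permCongr_apply]
    have h2 : ∀ x, σ (g x) = g (τ x) := fun x => by
      simp [hσdef, Ψ, hgx, Equiv.permCongr_apply]
    have hsg : Equiv.Perm.sign σ = Equiv.Perm.sign τ := by
      simp [hσdef, Ψ, Equiv.Perm.sign_permCongr]
    have hol := otherLeaders_eq_map (σ := σ) (τ := τ) g hg (P := fun _ => False)
      (fun x => by
        simp only [iff_false]
        intro h
        obtain ⟨t, ht⟩ := h.exists_nat_pow_eq
        rw [Equiv.Perm.pow_apply_eq_self_of_apply_eq_self h1] at ht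
        exact hgf x ht.symm) (fun x _ y _ => h2 y)
    rw [hsg, cycleProd_of_fixed A h1, hol, mul_smul_comm]
    congr 2
    simp only [not_false_eq_true, Finset.filter_true]
    exact prod_sort_map_eq g _ fun x _ =>
      cycleProd_apply_eq g.injective (fun y _ => h2 y) (fun y _ => rfl)
  · refine Finset.sum_congr rfl fun j _ => ?_
    rw [rdet, Finset.mul_sum, ← Finset.sum_neg_distrib]
    refine Finset.sum_congr rfl fun τ _ => ?_
    set σ := Ψ (some j, τ) with hσdef
    have h1 : σ f = g j := by simp [hσdef, Ψ, hfdef, hgx, Equiv.permCongr_apply]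
    have h2 : ∀ x, τ x ≠ j → σ (g x) = g (τ x) := fun x hx => by
      simp [hσdef, Ψ, hgx, Equiv.permCongr_apply]
      rw [Equiv.swap_apply_of_ne_of_ne] <;> simp [hx]
    have h3 : ∀ x, τ x = j → σ (g x) = f := fun x hx => by
      simp [hσdef, Ψ, hgx, hfdef, Equiv.permCongr_apply, hx]
    have hsg : Equiv.Perm.sign σ = - Equiv.Perm.sign τ := by
      simp [hσdef, Ψ, Equiv.Perm.sign_permCongr]
    have hne : ∀ x, ¬ τ.SameCycle j x → ∀ y, τ.SameCycle x y → τ y ≠ j := by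
      intro x hx y hy hyj
      exact hx ((hyj ▸ (Equiv.Perm.sameCycle_apply_right.2 hy)).symm)
    have h2' : ∀ x, ¬ τ.SameCycle j x → ∀ y, τ.SameCycle x y → σ (g y) = g (τ y) :=
      fun x hx y hy => h2 y (hne x hx y hy)
    have hP : ∀ x, σ.SameCycle f (g x) ↔ τ.SameCycle j x := by
      intro x
      constructor
      · intro h
        by_contra hx
        obtain ⟨t, ht⟩ := h.symm.exists_nat_pow_eq
        rw [pow_apply_comm_of_sameCycle (h2' x hx)] at ht
        exact hgf _ ht
      · intro h
        have hj : σ.SameCycle f (g j) := ⟨1, by simp [h1]⟩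
        obtain ⟨t, rfl⟩ := h.exists_nat_pow_eq
        clear h
        induction t with
        | zero => exact hj
        | succ t ih =>
          rw [pow_succ', Equiv.Perm.mul_apply]
          by_cases hc : τ ((τ ^ t) j) = j
          · rw [hc]; exact hj
          · rw [← h2 _ hc, Equiv.Perm.sameCycle_apply_right]
            exact ih
    have hol := otherLeaders_eq_map (σ := σ) (τ := τ) g hg hP h2'
    have hol' : ((leaders τ).filter fun x => ¬ τ.SameCycle j x) = otherLeaders τ j := by
      ext x
      simp [mem_leaders, mem_otherLeaders, and_comm]
    rw [hsg, cycleProd_insert hgf h1 h2 h3, hol, hol', mul_smul_comm, mul_assoc,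
      Units.smul_def, Units.smul_def, Units.val_neg, neg_smul]
    congr 4
    refine prod_sort_map_eq g _ fun x hx =>
      cycleProd_apply_eq g.injective (h2' x (mem_otherLeaders.1 hx).1) (fun y hy => ?_)
    rw [Matrix.updateCol_ne (hne x (mem_otherLeaders.1 hx).1 y hy)]
    rfl

end Perm

/-! ### Repetition-free lists: the interiors of paths -/

section Lists

variable {ι M : Type*} [DecidableEq ι] [AddCommMonoid M]

/-- The lists without repetitions with entries in `T`. -/
def nodupLists (T : Finset ι) : Finset (List ι) :=
  T.powerset.biUnion fun s => (Multiset.lists s.val).toFinset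

theorem mem_nodupLists {T : Finset ι} {l : List ι} :
    l ∈ nodupLists T ↔ l.Nodup ∧ ∀ x ∈ l, x ∈ T := by
  simp only [nodupLists, Finset.mem_biUnion, Finset.mem_powerset, Multiset.mem_toFinset,
    Multiset.mem_lists_iff]
  constructor
  · rintro ⟨s, hs, h⟩
    have h' : s.val = (l : Multiset ι) := h
    refine ⟨?_, fun x hx => hs ?_⟩
    · rw [← Multiset.coe_nodup, ← h']; exact s.nodup
    · rw [← Finset.mem_val, h']; exact hx
  · rintro ⟨h1, h2⟩
    refine ⟨⟨(l : Multiset ι), Multiset.coe_nodup.2 h1⟩, fun x hx => h2 x (by simpa using hx), rfl⟩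

theorem sum_nodupLists (T : Finset ι) (F : List ι → M) :
    ∑ l ∈ nodupLists T, F l = F [] + ∑ a ∈ T, ∑ l ∈ nodupLists (T.erase a), F (a :: l) := by
  have h : nodupLists T = insert []
      ((T.sigma fun a => nodupLists (T.erase a)).image fun p => p.1 :: p.2) := by
    ext l
    cases l with
    | nil => simp [mem_nodupLists]
    | cons a l =>
      simp only [mem_nodupLists, Finset.mem_insert, Finset.mem_image, Finset.mem_sigma,
        List.nodup_cons, List.mem_cons, reduceCtorEq, false_or, Finset.mem_erase]
      constructor
      · rintro ⟨⟨h1, h2⟩, h3⟩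
        exact ⟨⟨a, l⟩, ⟨h3 a (Or.inl rfl), h2, fun x hx =>
          ⟨fun hxa => h1 ((show x = a from hxa) ▸ hx), h3 x (Or.inr hx)⟩⟩, rfl⟩
      · rintro ⟨⟨b, l'⟩, ⟨h1, h2, h3⟩, h4⟩
        obtain ⟨rfl, rfl⟩ := List.cons.inj h4
        refine ⟨⟨fun hb => (h3 _ hb).1 rfl, h2⟩, ?_⟩
        rintro x (rfl | hx)
        · exact h1
        · exact (h3 x hx).2
  rw [h, Finset.sum_insert (by simp), Finset.sum_image, Finset.sum_sigma]
  rintro ⟨a, l⟩ _ ⟨b, l'⟩ _ hab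
  obtain ⟨rfl, rfl⟩ := List.cons.inj hab
  rfl

end Lists

/-! ### Row determinants of principal submatrices as sums over paths -/

section RowDetOn

variable {ι R : Type*} [LinearOrder ι] [Ring R]

/-- The row determinant of the principal submatrix of `A` on `T` (zero if `j ∉ T`). -/
noncomputable def rdetOn (A : Matrix ι ι R) (T : Finset ι) (j : ι) : R :=
  if h : j ∈ T then rdet (A.submatrix (fun x : T => (x : ι)) (fun x : T => (x : ι))) ⟨j, h⟩ else 0

/-- The Hermitian determinant of the principal submatrix of `A` on `T`. -/
noncomputable def hdetOn (A : Matrix ι ι R) (T : Finset ι) : R :=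
  hdet (A.submatrix (fun x : T => (x : ι)) (fun x : T => (x : ι)))

theorem submatrix_val_congr {A B : Matrix ι ι R} {T : Finset ι}
    (h : ∀ x ∈ T, ∀ y ∈ T, A x y = B x y) :
    A.submatrix (fun x : T => (x : ι)) (fun x : T => (x : ι)) =
      B.submatrix (fun x : T => (x : ι)) (fun x : T => (x : ι)) := by
  ext x y
  exact h x x.2 y y.2

theorem rdetOn_congr {A B : Matrix ι ι R} {T : Finset ι} {j : ι}
    (h : ∀ x ∈ T, ∀ y ∈ T, A x y = B x y) : rdetOn A T j = rdetOn B T j := by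
  simp only [rdetOn, submatrix_val_congr h]

theorem hdetOn_congr {A B : Matrix ι ι R} {T : Finset ι}
    (h : ∀ x ∈ T, ∀ y ∈ T, A x y = B x y) : hdetOn A T = hdetOn B T := by
  simp only [hdetOn, submatrix_val_congr h]

theorem hdetOn_empty (A : Matrix ι ι R) : hdetOn A ∅ = 1 := by
  simp [hdetOn, hdet]

theorem exists_hdetOn_eq (A : Matrix ι ι R) {T : Finset ι} (hT : T.Nonempty) :
    ∃ p ∈ T, hdetOn A T = rdetOn A T p := by
  have hne : (Finset.univ : Finset T).Nonempty := by simpa using hT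
  refine ⟨(Finset.univ.min' hne : T), Subtype.coe_prop _, ?_⟩
  rw [hdetOn, hdet, rdetOn, dif_pos hne, dif_pos (Finset.univ.min' hne).2]

theorem rdetOn_expand (A : Matrix ι ι R) {T : Finset ι} {j : ι} (hj : j ∈ T) :
    rdetOn A T j = A j j * hdetOn A (T.erase j) -
      ∑ a ∈ T.erase j, A j a * rdetOn (A.updateCol a fun x => A x j) (T.erase j) a := by
  let e₀ : Option (T.erase j : Finset ι) → T := fun o =>
    o.elim ⟨j, hj⟩ fun x => ⟨x, Finset.mem_of_mem_erase x.2⟩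
  have he₀ : Function.Bijective e₀ := by
    constructor
    · rintro (_ | x) (_ | y) h
      · rfl
      · exact absurd (congrArg Subtype.val h).symm (Finset.ne_of_mem_erase y.2)
      · exact absurd (congrArg Subtype.val h) (Finset.ne_of_mem_erase x.2)
      · have h' : (x : ι) = y := (Subtype.ext_iff.1 h : (e₀ (some x) : ι) = e₀ (some y))
        exact congrArg some (Subtype.ext h')
    · rintro ⟨x, hx⟩
      by_cases hxj : x = j
      · exact ⟨none, Subtype.ext hxj.symm⟩
      · exact ⟨some ⟨x, Finset.mem_erase.2 ⟨hxj, hx⟩⟩, rfl⟩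
  have key := rdet_expand (Equiv.ofBijective e₀ he₀) (fun a b => Iff.rfl)
    (A.submatrix (fun x : T => (x : ι)) (fun x : T => (x : ι)))
  rw [rdetOn, dif_pos hj]
  refine key.trans ?_
  congr 1
  rw [← Finset.sum_coe_sort (T.erase j)]
  refine Finset.sum_congr rfl fun a _ => ?_
  rw [rdetOn, dif_pos a.2]
  change A j a * _ = A j a * _
  congr 2
  ext x y
  simp only [Matrix.updateCol_apply, Matrix.submatrix_apply, Subtype.ext_iff]
  rfl

/-- The product of the entries of `A` along the path that starts in `j`, passes through `l` and ends
with the entry of the column `c`. -/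
def pathProd (A : Matrix ι ι R) (c : ι → R) : ι → List ι → R
  | j, [] => c j
  | j, a :: l => A j a * pathProd A c a l

/-- Matrices with one overwritten column are stable under `rdetOn_expand`: after a step from `j` to
`a`, the same column `c` sits in place `a`. The expansion therefore iterates, and `c` supplies the
closing entry of the cycle. -/
theorem rdetOn_updateCol (A : Matrix ι ι R) (c : ι → R) (T : Finset ι) {j : ι} (hj : j ∈ T) :
    rdetOn (A.updateCol j c) T j = ∑ l ∈ nodupLists (T.erase j),
      (-1) ^ l.length * (pathProd A c j l * hdetOn A (T.erase j \ l.toFinset)) := by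
  induction hn : T.card generalizing T j with
  | zero => simp_all
  | succ n ih =>
    rw [rdetOn_expand _ hj, sum_nodupLists, sub_eq_add_neg, ← Finset.sum_neg_distrib]
    congr 1
    · simp only [Matrix.updateCol_self, List.length_nil, pow_zero, pathProd, List.toFinset_nil,
        Finset.sdiff_empty, one_mul]
      congr 1
      exact hdetOn_congr fun x _ y hy => Matrix.updateCol_ne (Finset.ne_of_mem_erase hy)
    · refine Finset.sum_congr rfl fun a ha => ?_
      have haj := Finset.ne_of_mem_erase ha
      have h1 : rdetOn ((A.updateCol j c).updateCol a fun x => (A.updateCol j c) x j)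
          (T.erase j) a = rdetOn (A.updateCol a c) (T.erase j) a := by
        refine rdetOn_congr fun x _ y hy => ?_
        by_cases hya : y = a
        · subst hya
          simp
        · rw [Matrix.updateCol_ne hya, Matrix.updateCol_ne (Finset.ne_of_mem_erase hy),
            Matrix.updateCol_ne hya]
      rw [h1, ih (T.erase j) ha (by rw [Finset.card_erase_of_mem hj, hn]; rfl),
        Matrix.updateCol_ne haj, Finset.mul_sum, ← Finset.sum_neg_distrib]
      refine Finset.sum_congr rfl fun l _ => ?_
      have h2 : T.erase j \ (a :: l).toFinset = (T.erase j).erase a \ l.toFinset := by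
        ext x
        simp only [Finset.mem_sdiff, List.mem_toFinset, List.mem_cons, Finset.mem_erase]
        tauto
      rw [h2, List.length_cons, pathProd, pow_succ]
      simp only [mul_neg, neg_mul, mul_one, neg_inj]
      rw [← mul_assoc, (Commute.neg_one_right (A j a)).pow_right l.length |>.eq]
      simp only [mul_assoc]

/-- As `pathProd`, along a cycle through `f`, with the row `f` replaced by `b`. -/
def rowPath (A : Matrix ι ι R) (b : ι → R) (f : ι) : List ι → R
  | [] => b f
  | a :: l => b a * pathProd A (fun x => A x f) a l

theorem pathProd_congr {A B : Matrix ι ι R} {c d : ι → R} {j : ι} {l : List ι} {S : Set ι}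
    (hA : ∀ x ∈ S, ∀ y, A x y = B x y) (hc : ∀ x ∈ S, c x = d x) (hj : j ∈ S)
    (hl : ∀ x ∈ l, x ∈ S) : pathProd A c j l = pathProd B d j l := by
  induction l generalizing j with
  | nil => exact hc j hj
  | cons a l ih =>
    rw [pathProd, pathProd, hA j hj, ih (hl a (by simp)) fun x hx => hl x (by simp [hx])]

theorem rdetOn_updateRow (A : Matrix ι ι R) (b : ι → R) {T : Finset ι} {f : ι} (hf : f ∈ T) :
    rdetOn (A.updateRow f b) T f = ∑ l ∈ nodupLists (T.erase f),
      (-1) ^ l.length * (rowPath A b f l * hdetOn A (T.erase f \ l.toFinset)) := by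
  -- A vacuous column update makes `rdetOn_updateCol` applicable. Since the path leaves `f` only
  -- once, `b` enters only through the first factor.
  have h1 : A.updateRow f b = (A.updateRow f b).updateCol f fun x => (A.updateRow f b) x f := by
    ext x y
    by_cases hy : y = f
    · subst hy; simp
    · rw [Matrix.updateCol_ne hy]
  rw [h1, rdetOn_updateCol _ _ T hf]
  refine Finset.sum_congr rfl fun l hl => ?_
  have hlf := (mem_nodupLists.1 hl).2
  congr 2
  · cases l with
    | nil => simp [pathProd, rowPath]
    | cons a l =>
      rw [pathProd, rowPath, Matrix.updateRow_self]
      congr 1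
      refine pathProd_congr (S := {x | x ≠ f}) (fun x hx y => congrFun (Matrix.updateRow_ne hx) y)
        (fun x hx => by rw [Matrix.updateRow_ne hx])
        (Finset.ne_of_mem_erase (hlf a (by simp)))
        fun x hx => Finset.ne_of_mem_erase (hlf x (by simp [hx]))
  · exact hdetOn_congr fun x hx y _ =>
      congrFun (Matrix.updateRow_ne (Finset.ne_of_mem_erase (Finset.mem_sdiff.1 hx).1)) y

theorem rowPath_self (A : Matrix ι ι R) (p f : ι) (l : List ι) :
    rowPath A (A p) f l = pathProd A (fun x => A x f) p l := by
  cases l <;> rfl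

theorem pathProd_append (A : Matrix ι ι R) (c : ι → R) (a q : ι) (l₁ l₂ : List ι) :
    pathProd A c a (l₁ ++ q :: l₂) = pathProd A (fun x => A x q) a l₁ * pathProd A c q l₂ := by
  induction l₁ generalizing a with
  | nil => rfl
  | cons x l₁ ih => rw [List.cons_append, pathProd, ih, pathProd, mul_assoc]

theorem star_pathProd [StarRing R] {A : Matrix ι ι R} (hA : A.IsHermitian) (a f : ι) (l : List ι) :
    star (pathProd A (fun x => A x f) a l) = pathProd A (fun x => A x a) f l.reverse := by
  induction l generalizing a with
  | nil => exact hA.apply f a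
  | cons x l ih =>
    rw [pathProd, star_mul, ih, List.reverse_cons, pathProd_append]
    congr 1
    exact hA.apply x a

end RowDetOn

/-! ### Cutting paths at a vertex and exchanging disjoint paths -/

section Lists

variable {ι M : Type*} [DecidableEq ι] [AddCommMonoid M]

theorem filter_notMem_nodupLists (S : Finset ι) (q : ι) :
    (nodupLists S).filter (fun l => q ∉ l) = nodupLists (S.erase q) := by
  ext l
  simp only [Finset.mem_filter, mem_nodupLists, Finset.mem_erase]
  constructor
  · rintro ⟨⟨h1, h2⟩, h3⟩
    exact ⟨h1, fun x hx => ⟨fun h => h3 (h ▸ hx), h2 x hx⟩⟩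
  · rintro ⟨h1, h2⟩
    exact ⟨⟨h1, fun x hx => (h2 x hx).2⟩, fun h => (h2 q h).1 rfl⟩

theorem sum_filter_mem_nodupLists {S : Finset ι} {q : ι} (hq : q ∈ S) (F : List ι → M) :
    ∑ l ∈ (nodupLists S).filter (fun l => q ∈ l), F l =
      ∑ l₁ ∈ nodupLists (S.erase q), ∑ l₂ ∈ nodupLists (S.erase q \ l₁.toFinset),
        F (l₁ ++ q :: l₂) := by
  rw [Finset.sum_sigma']
  symm
  refine Finset.sum_bij (fun p _ => p.1 ++ q :: p.2) ?_ ?_ ?_ (fun _ _ => rfl)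
  · rintro ⟨l₁, l₂⟩ h
    simp only [Finset.mem_sigma, mem_nodupLists, Finset.mem_erase, Finset.mem_sdiff,
      List.mem_toFinset] at h
    obtain ⟨⟨h1, h2⟩, h3, h4⟩ := h
    simp only [Finset.mem_filter, mem_nodupLists, List.mem_append, List.mem_cons,
      List.nodup_append, List.nodup_cons, true_or, or_true, and_true]
    refine ⟨⟨h1, ⟨fun h => (h4 q h).1.1 rfl, h3⟩, ?_⟩, ?_⟩
    · rintro a ha b (rfl | hb) rfl
      · exact (h2 _ ha).1 rfl
      · exact (h4 _ hb).2 ha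
    · rintro x (hx | rfl | hx)
      · exact (h2 x hx).2
      · exact hq
      · exact (h4 x hx).1.2
  · rintro ⟨l₁, l₂⟩ h ⟨l₁', l₂'⟩ h' heq
    simp only [Finset.mem_sigma, mem_nodupLists, Finset.mem_erase, Finset.mem_sdiff,
      List.mem_toFinset] at h h'
    obtain ⟨rfl, -, rfl⟩ := (List.append_cons_inj_of_notMem
      (fun hq => (h.1.2 q hq).1 rfl) (fun hq => (h.2.2 q hq).1.1 rfl)).1 heq
    rfl
  · intro l hl
    simp only [Finset.mem_filter, mem_nodupLists] at hl
    obtain ⟨⟨h1, h2⟩, h3⟩ := hl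
    obtain ⟨l₁, l₂, rfl⟩ := List.append_of_mem h3
    simp only [List.mem_append, List.mem_cons, List.nodup_append, List.nodup_cons] at h1 h2
    refine ⟨⟨l₁, l₂⟩, ?_, rfl⟩
    simp only [Finset.mem_sigma, mem_nodupLists, Finset.mem_erase, Finset.mem_sdiff,
      List.mem_toFinset]
    refine ⟨⟨h1.1, fun x hx => ⟨h1.2.2 x hx q (Or.inl rfl), h2 x (Or.inl hx)⟩⟩, h1.2.1.2,
      fun x hx => ⟨⟨fun h => h1.2.1.1 (h ▸ hx), h2 x (Or.inr (Or.inr hx))⟩,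
        fun hx1 => h1.2.2 x hx1 x (Or.inr hx) rfl⟩⟩

theorem sum_nodupLists_split {S : Finset ι} {q : ι} (hq : q ∈ S) (F : List ι → M) :
    ∑ l ∈ nodupLists S, F l = ∑ l ∈ nodupLists (S.erase q), F l +
      ∑ l₁ ∈ nodupLists (S.erase q), ∑ l₂ ∈ nodupLists (S.erase q \ l₁.toFinset),
        F (l₁ ++ q :: l₂) := by
  rw [← sum_filter_mem_nodupLists hq, ← filter_notMem_nodupLists S q, add_comm,
    Finset.sum_filter_add_sum_filter_not]

theorem sum_nodupLists_comm (S : Finset ι) (F : List ι → List ι → M) :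
    ∑ l₁ ∈ nodupLists S, ∑ l₂ ∈ nodupLists (S \ l₁.toFinset), F l₁ l₂ =
      ∑ l₂ ∈ nodupLists S, ∑ l₁ ∈ nodupLists (S \ l₂.toFinset), F l₁ l₂ := by
  refine Finset.sum_comm' fun l₁ l₂ => ?_
  simp only [mem_nodupLists, Finset.mem_sdiff, List.mem_toFinset]
  constructor
  · rintro ⟨⟨h1, h2⟩, h3, h4⟩
    exact ⟨⟨h1, fun x hx => ⟨h2 x hx, fun hx2 => (h4 x hx2).2 hx⟩⟩, h3, fun x hx => (h4 x hx).1⟩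
  · rintro ⟨⟨h1, h2⟩, h3, h4⟩
    exact ⟨⟨h1, fun x hx => (h2 x hx).1⟩, h3, fun x hx => ⟨h4 x hx, fun hx2 => (h2 x hx2).2 hx⟩⟩

theorem erase_sdiff_append (T : Finset ι) (q : ι) (l₁ l₂ : List ι) :
    T \ (l₁ ++ q :: l₂).toFinset = (T.erase q \ l₁.toFinset) \ l₂.toFinset := by
  ext x
  simp only [Finset.mem_sdiff, List.mem_toFinset, List.mem_append, List.mem_cons, Finset.mem_erase]
  tauto

end Lists

/-! ### Row determinants of Hermitian quaternion matrices -/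

section Hermitian

variable {ι : Type*} [LinearOrder ι] {G : Matrix ι ι ℍ[ℝ]}

/-- The product of the entries of `G` along the path from `p` through `l` to `f`. -/
abbrev walk (G : Matrix ι ι ℍ[ℝ]) (p f : ι) (l : List ι) : ℍ[ℝ] :=
  pathProd G (fun x => G x f) p l

theorem re_mul_comm (a b : ℍ[ℝ]) : (a * b).re = (b * a).re := by
  simp only [Quaternion.re_mul]
  ring

theorem neg_one_pow_eq_coe (k : ℕ) : ((-1 : ℍ[ℝ]) ^ k) = (((-1 : ℝ) ^ k : ℝ) : ℍ[ℝ]) := by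
  push_cast
  rfl

theorem rdetOn_updateRow_row (G : Matrix ι ι ℍ[ℝ]) {T : Finset ι} {f : ι} (hf : f ∈ T) (p : ι) :
    rdetOn (G.updateRow f (G p)) T f = ∑ l ∈ nodupLists (T.erase f),
      (-1) ^ l.length * (walk G p f l * hdetOn G (T.erase f \ l.toFinset)) := by
  rw [rdetOn_updateRow _ _ hf]
  simp only [rowPath_self]

theorem rdetOn_eq_sum (G : Matrix ι ι ℍ[ℝ]) {T : Finset ι} {p : ι} (hp : p ∈ T) :
    rdetOn G T p = ∑ l ∈ nodupLists (T.erase p),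
      (-1) ^ l.length * (walk G p p l * hdetOn G (T.erase p \ l.toFinset)) := by
  have h := rdetOn_updateRow_row G hp p
  rwa [Matrix.updateRow_eq_self] at h

theorem re_sum {α : Type*} (s : Finset α) (F : α → ℍ[ℝ]) :
    (∑ x ∈ s, F x).re = ∑ x ∈ s, (F x).re := by
  classical
  induction s using Finset.induction_on with
  | empty => simp
  | insert a s ha ih => rw [Finset.sum_insert ha, Finset.sum_insert ha, Quaternion.re_add, ih]

/-- The symmetric form of the row determinant of a Hermitian matrix: the cycles through two
prescribed indices are made explicit. -/
theorem re_rdetOn_eq {T : Finset ι} {p q : ι} (hp : p ∈ T) (hq : q ∈ T) (hpq : q ≠ p)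
    (ih : ∀ S, S.card < T.card → hdetOn G S = ((hdetOn G S).re : ℍ[ℝ]) ∧
      ∀ r ∈ S, rdetOn G S r = hdetOn G S) :
    (rdetOn G T p).re =
      (∑ l₁ ∈ nodupLists ((T.erase p).erase q),
        ∑ l₂ ∈ nodupLists ((T.erase p).erase q \ l₁.toFinset),
        (-1 : ℝ) ^ (l₁.length + l₂.length) * ((walk G p p l₁).re * (walk G q q l₂).re *
          (hdetOn G (((T.erase p).erase q \ l₁.toFinset) \ l₂.toFinset)).re)) +
      ∑ l₁ ∈ nodupLists ((T.erase p).erase q),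
        ∑ l₂ ∈ nodupLists ((T.erase p).erase q \ l₁.toFinset),
        (-1 : ℝ) ^ (l₁.length + l₂.length + 1) * ((walk G p q l₁ * walk G q p l₂).re *
          (hdetOn G (((T.erase p).erase q \ l₁.toFinset) \ l₂.toFinset)).re) := by
  have hlt : ∀ S, S ⊆ T.erase p → S.card < T.card := fun S hS =>
    (Finset.card_le_card hS).trans_lt (Finset.card_erase_lt_of_mem hp)
  have hre : ∀ (k : ℕ) (w : ℍ[ℝ]) (S : Finset ι), S ⊆ T.erase p →
      ((-1) ^ k * (w * hdetOn G S)).re = (-1 : ℝ) ^ k * (w.re * (hdetOn G S).re) := by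
    intro k w S hS
    rw [(ih S (hlt S hS)).1, neg_one_pow_eq_coe, Quaternion.coe_mul_eq_smul,
      Quaternion.mul_coe_eq_smul, Quaternion.re_smul, Quaternion.re_smul, Quaternion.re_coe,
      smul_eq_mul, smul_eq_mul, mul_comm w.re]
  have hqT : q ∈ T.erase p := Finset.mem_erase.2 ⟨hpq, hq⟩
  rw [rdetOn_eq_sum G hp, sum_nodupLists_split hqT, Quaternion.re_add]
  congr 1
  · rw [re_sum]
    refine Finset.sum_congr rfl fun l₁ hl₁ => ?_
    have hl := (mem_nodupLists.1 hl₁).2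
    have hq' : q ∈ T.erase p \ l₁.toFinset := by
      refine Finset.mem_sdiff.2 ⟨hqT, fun h => ?_⟩
      exact (Finset.mem_erase.1 (hl q (List.mem_toFinset.1 h))).1 rfl
    -- When the cycle through `p` avoids `q`, the leftover minor is smaller, so by induction it may
    -- be expanded at `q`.
    rw [hre _ _ _ Finset.sdiff_subset, ← (ih _ (hlt _ Finset.sdiff_subset)).2 q hq',
      rdetOn_eq_sum G hq', re_sum, Finset.mul_sum, Finset.mul_sum,
      ← Finset.erase_sdiff_comm (T.erase p)]
    refine Finset.sum_congr rfl fun l₂ _ => ?_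
    rw [hre _ _ _ ((Finset.sdiff_subset.trans Finset.sdiff_subset).trans (Finset.erase_subset _ _)),
      pow_add]
    ring
  · rw [re_sum]
    refine Finset.sum_congr rfl fun l₁ _ => ?_
    rw [re_sum]
    refine Finset.sum_congr rfl fun l₂ _ => ?_
    rw [hre _ _ _ Finset.sdiff_subset, walk, pathProd_append, erase_sdiff_append]
    congr 2
    simp only [List.length_append, List.length_cons]
    ring

/-- Conjugating a closed walk reverses it, and the leftover minors are real, so reversing the lists
shows that the sum is self-conjugate. -/
theorem sum_walk_eq_coe_re (hG : G.IsHermitian) (S : Finset ι) (p : ι)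
    (h : ∀ S' ⊆ S, hdetOn G S' = ((hdetOn G S').re : ℍ[ℝ])) :
    ∑ l ∈ nodupLists S, (-1) ^ l.length * (walk G p p l * hdetOn G (S \ l.toFinset)) =
      ((∑ l ∈ nodupLists S,
        (-1) ^ l.length * (walk G p p l * hdetOn G (S \ l.toFinset))).re : ℍ[ℝ]) := by
  rw [← Quaternion.star_eq_self, star_sum]
  refine Finset.sum_nbij' List.reverse List.reverse ?_ ?_ (fun l _ => List.reverse_reverse l)
    (fun l _ => List.reverse_reverse l) ?_
  · intro l hl
    simpa [mem_nodupLists] using hl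
  · intro l hl
    simpa [mem_nodupLists] using hl
  · intro l _
    have h1 := h (S \ l.toFinset) Finset.sdiff_subset
    rw [List.length_reverse, List.toFinset_reverse, h1, neg_one_pow_eq_coe]
    simp only [star_mul, Quaternion.star_coe, star_pathProd hG]
    rw [← Quaternion.coe_commutes, Quaternion.coe_commutes _ (pathProd _ _ _ _)]

/-- All the row determinants of a Hermitian matrix coincide, and they are real. -/
theorem hdetOn_spec (hG : G.IsHermitian) (T : Finset ι) :
    hdetOn G T = ((hdetOn G T).re : ℍ[ℝ]) ∧ ∀ p ∈ T, rdetOn G T p = hdetOn G T := by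
  induction hn : T.card using Nat.strong_induction_on generalizing T with
  | _ n ih =>
    subst hn
    have ih' : ∀ S : Finset ι, S.card < T.card → hdetOn G S = ((hdetOn G S).re : ℍ[ℝ]) ∧
      ∀ r ∈ S, rdetOn G S r = hdetOn G S := fun S hS => ih _ hS S rfl
    have hreal : ∀ p ∈ T, rdetOn G T p = ((rdetOn G T p).re : ℍ[ℝ]) := by
      intro p hp
      rw [rdetOn_eq_sum G hp]
      exact sum_walk_eq_coe_re hG _ p fun S hS => (ih' S ((Finset.card_le_card hS).trans_lt
        (Finset.card_erase_lt_of_mem hp))).1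
    have heq : ∀ p ∈ T, ∀ q ∈ T, rdetOn G T p = rdetOn G T q := by
      intro p hp q hq
      by_cases hpq : q = p
      · rw [hpq]
      -- Both values are real, so real parts suffice. The formula is symmetric in `p` and `q` after
      -- exchanging the two lists, since `Re (ab) = Re (ba)`.
      rw [hreal p hp, hreal q hq, re_rdetOn_eq hp hq hpq ih',
        re_rdetOn_eq hq hp (Ne.symm hpq) ih', Finset.erase_right_comm]
      congr 2
      · rw [sum_nodupLists_comm]
        refine Finset.sum_congr rfl fun l₁ _ => Finset.sum_congr rfl fun l₂ _ => ?_
        rw [sdiff_right_comm, add_comm, mul_comm (walk G p p l₂).re]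
      · rw [sum_nodupLists_comm]
        refine Finset.sum_congr rfl fun l₁ _ => Finset.sum_congr rfl fun l₂ _ => ?_
        rw [sdiff_right_comm, add_comm l₁.length, re_mul_comm]
    rcases T.eq_empty_or_nonempty with rfl | hT
    · simp [hdetOn_empty]
    · obtain ⟨p, hp, hpe⟩ := exists_hdetOn_eq G hT
      rw [hpe]
      exact ⟨hreal p hp, fun q hq => heq q hq p hp⟩

theorem hdetOn_eq_coe (hG : G.IsHermitian) (T : Finset ι) :
    hdetOn G T = ((hdetOn G T).re : ℍ[ℝ]) :=
  (hdetOn_spec hG T).1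

theorem rdetOn_eq_hdetOn (hG : G.IsHermitian) {T : Finset ι} {p : ι} (hp : p ∈ T) :
    rdetOn G T p = hdetOn G T :=
  (hdetOn_spec hG T).2 p hp

/-- A row determinant of a Hermitian matrix in which a row is replaced by another one is zero. -/
theorem rdetOn_updateRow_row_eq_zero (hG : G.IsHermitian) {T : Finset ι} {f x : ι} (hf : f ∈ T)
    (hx : x ∈ T) (hxf : x ≠ f) : rdetOn (G.updateRow f (G x)) T f = 0 := by
  have hxT : x ∈ T.erase f := Finset.mem_erase.2 ⟨hxf, hx⟩
  rw [rdetOn_updateRow_row G hf, sum_nodupLists_split hxT, sum_nodupLists_comm,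
    ← Finset.sum_add_distrib]
  refine Finset.sum_eq_zero fun l hl => ?_
  have hx' : x ∈ T.erase f \ l.toFinset := by
    refine Finset.mem_sdiff.2 ⟨hxT, fun h => ?_⟩
    exact (Finset.mem_erase.1 ((mem_nodupLists.1 hl).2 x (List.mem_toFinset.1 h))).1 rfl
  -- The minor is real, hence central. Moved to the front and expanded at `x`, it yields closed
  -- walks at `x` followed by `l`; these cancel the walks that return to `x`, which have one more
  -- vertex and so the opposite sign.
  have hcomm : walk G x f l * hdetOn G (T.erase f \ l.toFinset) =
      hdetOn G (T.erase f \ l.toFinset) * walk G x f l := by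
    rw [hdetOn_eq_coe hG, Quaternion.coe_commutes]
  rw [hcomm, ← rdetOn_eq_hdetOn hG hx', rdetOn_eq_sum G hx', Finset.sum_mul, Finset.mul_sum,
    ← Finset.erase_sdiff_comm (T.erase f), ← Finset.sum_add_distrib]
  refine Finset.sum_eq_zero fun l' _ => ?_
  rw [show walk G x f (l' ++ x :: l) = walk G x x l' * walk G x f l from pathProd_append ..,
    erase_sdiff_append, sdiff_right_comm, hdetOn_eq_coe hG,
    neg_one_pow_eq_coe, neg_one_pow_eq_coe, neg_one_pow_eq_coe, List.length_append,
    List.length_cons, Quaternion.coe_commutes]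
  simp only [Quaternion.coe_mul_eq_smul, Quaternion.mul_coe_eq_smul, smul_mul_assoc, mul_smul_comm,
    smul_smul, ← add_smul]
  convert zero_smul ℝ _ using 2
  ring

theorem rdetOn_updateRow_single_self (G : Matrix ι ι ℍ[ℝ]) {T : Finset ι} {f : ι} (hf : f ∈ T) :
    rdetOn (G.updateRow f (Pi.single f 1)) T f = hdetOn G (T.erase f) := by
  rw [rdetOn_updateRow _ _ hf, sum_nodupLists, Finset.sum_eq_zero, add_zero]
  · simp [rowPath]
  · intro a ha
    simp [rowPath, Pi.single_eq_of_ne (Finset.ne_of_mem_erase ha)]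

/-- Only paths whose first step goes to `x` survive. What follows that step is a path that starts
with row `x` and never meets `x` again; the sign pays for the lost vertex. -/
theorem rdetOn_updateRow_single (G : Matrix ι ι ℍ[ℝ]) {T : Finset ι} {f x : ι} (hf : f ∈ T)
    (hx : x ∈ T) (hxf : x ≠ f) :
    rdetOn (G.updateRow f (Pi.single x 1)) T f =
      - rdetOn (G.updateRow f (G x)) (T.erase x) f := by
  have hf' : f ∈ T.erase x := Finset.mem_erase.2 ⟨hxf.symm, hf⟩
  have hxT : x ∈ T.erase f := Finset.mem_erase.2 ⟨hxf, hx⟩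
  rw [rdetOn_updateRow _ _ hf, sum_nodupLists, rdetOn_updateRow_row _ hf', Finset.erase_right_comm,
    Finset.sum_eq_single_of_mem x hxT]
  · simp only [List.length_nil, pow_zero, rowPath, Pi.single_eq_of_ne hxf.symm, zero_mul, one_mul,
      mul_zero, zero_add, List.length_cons, Pi.single_eq_same, ← Finset.sum_neg_distrib]
    refine Finset.sum_congr rfl fun l _ => ?_
    have h2 : T.erase f \ (x :: l).toFinset = (T.erase f).erase x \ l.toFinset :=
      (erase_sdiff_append _ x [] l).trans (by simp)
    rw [h2, pow_succ]
    simp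
  · intro a _ ha
    simp [rowPath, Pi.single_eq_of_ne ha]

theorem rdetOn_updateRow_single_eq_zero (G : Matrix ι ι ℍ[ℝ]) {T : Finset ι} {f x : ι}
    (hf : f ∈ T) (hx : x ∉ T) : rdetOn (G.updateRow f (Pi.single x 1)) T f = 0 := by
  rw [rdetOn_updateRow _ _ hf]
  refine Finset.sum_eq_zero fun l hl => ?_
  have hl := (mem_nodupLists.1 hl).2
  cases l with
  | nil =>
    have : f ≠ x := by rintro rfl; exact hx hf
    simp [rowPath, Pi.single_eq_of_ne this]
  | cons a l =>
    have : a ≠ x := by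
      rintro rfl
      exact hx (Finset.mem_of_mem_erase (hl a (by simp)))
    simp [rowPath, Pi.single_eq_of_ne this]

theorem rdetOn_updateRow_eq_sum [Fintype ι] (G : Matrix ι ι ℍ[ℝ]) (b : ι → ℍ[ℝ]) {T : Finset ι}
    {f : ι} (hf : f ∈ T) : rdetOn (G.updateRow f b) T f =
      ∑ a, b a * rdetOn (G.updateRow f (Pi.single a 1)) T f := by
  simp only [rdetOn_updateRow _ _ hf, Finset.mul_sum]
  rw [Finset.sum_comm]
  refine Finset.sum_congr rfl fun l _ => ?_
  have h : rowPath G b f l = ∑ a, b a * rowPath G (Pi.single a 1) f l := by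
    cases l with
    | nil => simp [rowPath, Pi.single_apply]
    | cons c l => simp [rowPath, Pi.single_apply]
  rw [h, Finset.sum_mul, Finset.mul_sum]
  refine Finset.sum_congr rfl fun a _ => ?_
  rw [neg_one_pow_eq_coe]
  simp only [← mul_assoc]
  rw [Quaternion.coe_commutes]

end Hermitian

/-! ### Cofactor sums and the Faddeev–LeVerrier recursion -/

section Cofactor

variable {n : ℕ}

theorem sumMinors_eq_sum (r : ℕ) (G : Matrix (Fin n) (Fin n) ℍ[ℝ]) :
    sumMinors r G = ∑ α ∈ Finset.powersetCard r Finset.univ, hdetOn G α := by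
  rw [Finset.sum_subtype (p := fun α : Finset (Fin n) => α.card = r) _ (by simp)]
  rfl

theorem sumRdet_eq_sum (r : ℕ) (G : Matrix (Fin n) (Fin n) ℍ[ℝ]) (f : Fin n) (b : Fin n → ℍ[ℝ]) :
    sumRdet r G f b = ∑ α ∈ (Finset.powersetCard r Finset.univ).filter (f ∈ ·),
      rdetOn (G.updateRow f b) α f := by
  rw [Finset.sum_subtype (p := fun α : Finset (Fin n) => α.card = r ∧ f ∈ α) _ (by simp)]
  refine Finset.sum_congr rfl fun α _ => ?_
  rw [rdetOn, dif_pos α.2.2]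
  rfl

/-- The sum of the principal minors of order `r`, as a real number. -/
noncomputable def minorSum (r : ℕ) (G : Matrix (Fin n) (Fin n) ℍ[ℝ]) : ℝ :=
  ∑ α ∈ Finset.powersetCard r Finset.univ, (hdetOn G α).re

/-- The matrix of the linear map `b ↦ (sumRdet r G f b)_f`. -/
noncomputable def cofactorSum (r : ℕ) (G : Matrix (Fin n) (Fin n) ℍ[ℝ]) :
    Matrix (Fin n) (Fin n) ℍ[ℝ] :=
  Matrix.of fun a f => sumRdet r G f (Pi.single a 1)

theorem coe_real_sum {α : Type*} (s : Finset α) (F : α → ℝ) :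
    ((∑ x ∈ s, F x : ℝ) : ℍ[ℝ]) = ∑ x ∈ s, (F x : ℍ[ℝ]) := by
  classical
  induction s using Finset.induction_on with
  | empty => simp
  | insert a s ha ih => rw [Finset.sum_insert ha, Finset.sum_insert ha, Quaternion.coe_add, ih]

theorem sumMinors_eq_coe {G : Matrix (Fin n) (Fin n) ℍ[ℝ]} (hG : G.IsHermitian) (r : ℕ) :
    sumMinors r G = (minorSum r G : ℍ[ℝ]) := by
  rw [sumMinors_eq_sum, minorSum, coe_real_sum]
  exact Finset.sum_congr rfl fun α _ => hdetOn_eq_coe hG α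

theorem sumRdet_eq_mul (r : ℕ) (G : Matrix (Fin n) (Fin n) ℍ[ℝ]) (f : Fin n) (b : Fin n → ℍ[ℝ]) :
    sumRdet r G f b = ∑ a, b a * cofactorSum r G a f := by
  simp only [cofactorSum, Matrix.of_apply, sumRdet_eq_sum, Finset.mul_sum]
  rw [Finset.sum_comm]
  exact Finset.sum_congr rfl fun α hα => rdetOn_updateRow_eq_sum G b (Finset.mem_filter.1 hα).2

theorem mul_cofactorSum_apply {m : ℕ} (r : ℕ) (G : Matrix (Fin n) (Fin n) ℍ[ℝ])
    (B : Matrix (Fin m) (Fin n) ℍ[ℝ]) (i : Fin m) (f : Fin n) :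
    (B * cofactorSum r G) i f = sumRdet r G f (B i) := by
  rw [sumRdet_eq_mul, Matrix.mul_apply]

theorem sum_powersetCard_erase {ι M : Type*} [Fintype ι] [DecidableEq ι] [AddCommMonoid M] (r : ℕ)
    (x : ι) (F : Finset ι → M) :
    ∑ α ∈ (Finset.powersetCard (r + 1) Finset.univ).filter (x ∈ ·), F (α.erase x) =
      ∑ β ∈ (Finset.powersetCard r Finset.univ).filter (x ∉ ·), F β := by
  refine Finset.sum_nbij' (fun α => α.erase x) (fun β => insert x β) ?_ ?_ ?_ ?_ ?_
  · intro α hα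
    simp only [Finset.mem_filter, Finset.mem_powersetCard_univ] at hα ⊢
    exact ⟨by rw [Finset.card_erase_of_mem hα.2, hα.1]; rfl, Finset.notMem_erase _ _⟩
  · intro β hβ
    simp only [Finset.mem_filter, Finset.mem_powersetCard_univ] at hβ ⊢
    exact ⟨by rw [Finset.card_insert_of_notMem hβ.2, hβ.1], Finset.mem_insert_self _ _⟩
  · intro α hα
    exact Finset.insert_erase (Finset.mem_filter.1 hα).2
  · intro β hβ
    exact Finset.erase_insert (Finset.mem_filter.1 hβ).2
  · intro α _
    rfl

theorem sumRdet_row_self {G : Matrix (Fin n) (Fin n) ℍ[ℝ]} (hG : G.IsHermitian) (r : ℕ)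
    (f : Fin n) : sumRdet r G f (G f) =
      ∑ α ∈ (Finset.powersetCard r Finset.univ).filter (f ∈ ·), hdetOn G α := by
  rw [sumRdet_eq_sum]
  refine Finset.sum_congr rfl fun α hα => ?_
  rw [Matrix.updateRow_eq_self, rdetOn_eq_hdetOn hG (Finset.mem_filter.1 hα).2]

/-- On the diagonal, the two terms collect the minors of order `r` that contain `x` and those that
avoid it. Off the diagonal, index sets containing both `x` and `f` contribute zero to the product by
the repeated row, and a set `β` avoiding `x` cancels against `insert x β` in the second term. -/
theorem mul_cofactorSum_add {G : Matrix (Fin n) (Fin n) ℍ[ℝ]} (hG : G.IsHermitian) (r : ℕ) :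
    G * cofactorSum r G + cofactorSum (r + 1) G = minorSum r G • 1 := by
  ext1 x f
  rw [Matrix.add_apply, mul_cofactorSum_apply, cofactorSum, Matrix.of_apply, Matrix.smul_apply]
  by_cases hxf : x = f
  · subst hxf
    rw [sumRdet_row_self hG, sumRdet_eq_sum, Matrix.one_apply_eq]
    have h : ∑ α ∈ (Finset.powersetCard (r + 1) Finset.univ).filter (x ∈ ·),
        rdetOn (G.updateRow x (Pi.single x 1)) α x =
        ∑ α ∈ (Finset.powersetCard (r + 1) Finset.univ).filter (x ∈ ·), hdetOn G (α.erase x) :=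
      Finset.sum_congr rfl fun α hα => rdetOn_updateRow_single_self G (Finset.mem_filter.1 hα).2
    rw [h, sum_powersetCard_erase r x (hdetOn G), Finset.sum_filter_add_sum_filter_not,
      ← sumMinors_eq_sum, sumMinors_eq_coe hG]
    ext <;> simp
  · rw [Matrix.one_apply_ne hxf, smul_zero, sumRdet_eq_sum, sumRdet_eq_sum]
    have h1 : ∑ α ∈ (Finset.powersetCard r Finset.univ).filter (f ∈ ·),
        rdetOn (G.updateRow f (G x)) α f =
        ∑ β ∈ (Finset.powersetCard r Finset.univ).filter (x ∉ ·),
          if f ∈ β then rdetOn (G.updateRow f (G x)) β f else 0 := by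
      rw [← Finset.sum_filter, Finset.filter_filter, Finset.sum_filter, Finset.sum_filter]
      refine Finset.sum_congr rfl fun α _ => ?_
      by_cases hf : f ∈ α
      · by_cases hx : x ∈ α
        · simp [hf, hx, rdetOn_updateRow_row_eq_zero hG hf hx hxf]
        · simp [hf, hx]
      · simp [hf]
    have h2 : ∑ α ∈ (Finset.powersetCard (r + 1) Finset.univ).filter (f ∈ ·),
        rdetOn (G.updateRow f (Pi.single x 1)) α f =
        - ∑ α ∈ (Finset.powersetCard (r + 1) Finset.univ).filter (x ∈ ·),
          if f ∈ α.erase x then rdetOn (G.updateRow f (G x)) (α.erase x) f else 0 := by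
      rw [← Finset.sum_neg_distrib, Finset.sum_filter, Finset.sum_filter]
      refine Finset.sum_congr rfl fun α _ => ?_
      by_cases hf : f ∈ α
      · by_cases hx : x ∈ α
        · simp [hf, hx, Ne.symm hxf, rdetOn_updateRow_single G hf hx hxf]
        · simp [hf, hx, rdetOn_updateRow_single_eq_zero G hf hx]
      · simp [hf]
    rw [h1, h2, sum_powersetCard_erase r x
      (fun β => if f ∈ β then rdetOn (G.updateRow f (G x)) β f else 0), add_neg_cancel]

theorem minorSum_zero (G : Matrix (Fin n) (Fin n) ℍ[ℝ]) : minorSum 0 G = 1 := by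
  simp [minorSum, hdetOn_empty]

theorem minorSum_eq_zero (G : Matrix (Fin n) (Fin n) ℍ[ℝ]) {r : ℕ} (hr : n < r) :
    minorSum r G = 0 := by
  rw [minorSum, Finset.powersetCard_eq_empty.2 (by simpa using hr), Finset.sum_empty]

theorem cofactorSum_zero (G : Matrix (Fin n) (Fin n) ℍ[ℝ]) : cofactorSum 0 G = 0 := by
  ext1 a f
  rw [cofactorSum, Matrix.of_apply, sumRdet_eq_sum]
  refine Finset.sum_eq_zero fun α hα => ?_
  simp only [Finset.powersetCard_zero, Finset.mem_filter, Finset.mem_singleton] at hα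
  exact absurd hα.2 (hα.1 ▸ Finset.notMem_empty f)

theorem cofactorSum_eq_zero (G : Matrix (Fin n) (Fin n) ℍ[ℝ]) {r : ℕ} (hr : n < r) :
    cofactorSum r G = 0 := by
  ext1 a f
  rw [cofactorSum, Matrix.of_apply, sumRdet_eq_sum,
    Finset.powersetCard_eq_empty.2 (by simpa using hr)]
  simp

theorem cofactorSum_succ {G : Matrix (Fin n) (Fin n) ℍ[ℝ]} (hG : G.IsHermitian) (r : ℕ) :
    cofactorSum (r + 1) G = minorSum r G • 1 - G * cofactorSum r G := by
  rw [← mul_cofactorSum_add hG r, add_sub_cancel_left]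

/-- By the recursion, `cofactorSum r G` is a polynomial in `G` with real coefficients. -/
theorem commute_cofactorSum {G : Matrix (Fin n) (Fin n) ℍ[ℝ]} (hG : G.IsHermitian) (r : ℕ) :
    Commute G (cofactorSum r G) := by
  induction r with
  | zero => rw [cofactorSum_zero]; exact Commute.zero_right _
  | succ r ih =>
    rw [cofactorSum_succ hG]
    exact ((Commute.one_right G).smul_right _).sub_right ((Commute.refl G).mul_right ih)

theorem conjTranspose_real_smul {m p : ℕ} (c : ℝ) (A : Matrix (Fin m) (Fin p) ℍ[ℝ]) :
    (c • A).conjTranspose = c • A.conjTranspose := by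
  ext1 i j
  simp [Matrix.conjTranspose_apply, Quaternion.star_smul]

theorem isHermitian_cofactorSum {G : Matrix (Fin n) (Fin n) ℍ[ℝ]} (hG : G.IsHermitian) (r : ℕ) :
    (cofactorSum r G).IsHermitian := by
  induction r with
  | zero => rw [cofactorSum_zero]; exact Matrix.isHermitian_zero
  | succ r ih =>
    rw [cofactorSum_succ hG]
    refine Matrix.IsHermitian.sub ?_ ?_
    · rw [Matrix.IsHermitian, conjTranspose_real_smul, Matrix.conjTranspose_one]
    · rw [Matrix.IsHermitian, Matrix.conjTranspose_mul, ih.eq, hG.eq,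
        (commute_cofactorSum hG r).eq]

theorem eq_zero_of_mul_conjTranspose {m p : ℕ} {A : Matrix (Fin m) (Fin p) ℍ[ℝ]}
    (h : A * A.conjTranspose = 0) : A = 0 := by
  ext1 i j
  have h1 : ((A * A.conjTranspose) i i).re = 0 := by rw [h]; rfl
  rw [Matrix.mul_apply, re_sum] at h1
  have h2 : ∀ a : ℍ[ℝ], (a * star a).re = Quaternion.normSq a := fun a => rfl
  simp only [Matrix.conjTranspose_apply, h2] at h1
  exact Quaternion.normSq_eq_zero.1
    ((Finset.sum_eq_zero_iff_of_nonneg fun _ _ => Quaternion.normSq_nonneg).1 h1 j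
      (Finset.mem_univ j))

theorem mul_eq_zero_of_isHermitian {p : ℕ} {G : Matrix (Fin n) (Fin n) ℍ[ℝ]} (hG : G.IsHermitian)
    {Z : Matrix (Fin n) (Fin p) ℍ[ℝ]} (h : G * (G * Z) = 0) : G * Z = 0 := by
  have h1 : (G * Z).conjTranspose = 0 := by
    apply eq_zero_of_mul_conjTranspose
    rw [Matrix.conjTranspose_conjTranspose, Matrix.conjTranspose_mul, hG.eq, Matrix.mul_assoc, h,
      Matrix.mul_zero]
  rw [← Matrix.conjTranspose_conjTranspose (G * Z), h1, Matrix.conjTranspose_zero]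

/-- Each principal minor of order `r` is counted once for every element of its index set. -/
theorem re_trace_mul_cofactorSum {G : Matrix (Fin n) (Fin n) ℍ[ℝ]} (hG : G.IsHermitian) (r : ℕ) :
    (G * cofactorSum r G).trace.re = r * minorSum r G := by
  rw [Matrix.trace, re_sum]
  simp only [Matrix.diag_apply, mul_cofactorSum_apply, sumRdet_row_self hG, re_sum]
  simp only [Finset.sum_filter]
  rw [Finset.sum_comm, minorSum, Finset.mul_sum]
  refine Finset.sum_congr rfl fun α hα => ?_
  rw [Finset.sum_ite_mem, Finset.univ_inter, Finset.sum_const, nsmul_eq_mul,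
    (Finset.mem_powersetCard_univ.1 hα)]

theorem mul_cofactorSum_succ_eq_zero {G : Matrix (Fin n) (Fin n) ℍ[ℝ]} (hG : G.IsHermitian) {t : ℕ}
    (ht : ∀ r, t < r → minorSum r G = 0) : G * cofactorSum (t + 1) G = 0 := by
  -- Descending induction on `r` from `n + 1`, where the cofactor sum is empty. Beyond `t` the
  -- recursion reads `C_{r+1} = -G C_r`, and a Hermitian `G` satisfies `G (G Z) = 0 → G Z = 0`.
  have key : ∀ j r, t < r → r + j = n + 1 → G * cofactorSum r G = 0 := by
    intro j
    induction j with
    | zero =>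
      intro r _ hj
      rw [cofactorSum_eq_zero G (by omega), Matrix.mul_zero]
    | succ j ih =>
      intro r hr hj
      have h := ih (r + 1) (by omega) (by omega)
      rw [cofactorSum_succ hG, ht r hr, zero_smul, zero_sub, Matrix.mul_neg, neg_eq_zero] at h
      exact mul_eq_zero_of_isHermitian hG h
  by_cases htn : t ≤ n
  · exact key (n - t) (t + 1) (by omega) (by omega)
  · rw [cofactorSum_eq_zero G (by omega), Matrix.mul_zero]

theorem exists_minorSum_ne_zero (G : Matrix (Fin n) (Fin n) ℍ[ℝ]) :
    ∃ t, minorSum t G ≠ 0 ∧ ∀ r, t < r → minorSum r G = 0 := by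
  classical
  have h0 : minorSum 0 G ≠ 0 := by rw [minorSum_zero]; exact one_ne_zero
  refine ⟨Nat.findGreatest (fun r => minorSum r G ≠ 0) n,
    Nat.findGreatest_spec (P := fun r => minorSum r G ≠ 0) (Nat.zero_le n) h0, fun r hr => ?_⟩
  by_cases hrn : r ≤ n
  · exact not_not.1 (Nat.findGreatest_is_greatest hr hrn)
  · exact minorSum_eq_zero G (by omega)

end Cofactor

/-! ### Column spaces, rank and the real trace -/

section LinearAlgebra

variable {m n p : ℕ}

theorem mem_colSpace {A : Matrix (Fin m) (Fin n) ℍ[ℝ]} {y : Fin m → ℍ[ℝ]} :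
    y ∈ colSpace A ↔ ∃ x, y = A.mulVec x :=
  Iff.rfl

theorem colSpace_mul_le (A : Matrix (Fin m) (Fin n) ℍ[ℝ]) (B : Matrix (Fin n) (Fin p) ℍ[ℝ]) :
    colSpace (A * B) ≤ colSpace A := by
  rintro _ ⟨x, rfl⟩
  exact ⟨B.mulVec x, (Matrix.mulVec_mulVec x A B).symm⟩

theorem mulVec_single_one_apply (A : Matrix (Fin m) (Fin n) ℍ[ℝ]) (i : Fin m) (j : Fin n) :
    A.mulVec (Pi.single j 1) i = A i j := by
  simp

theorem exists_eq_mul_of_colSpace_le {A : Matrix (Fin m) (Fin n) ℍ[ℝ]}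
    {B : Matrix (Fin m) (Fin p) ℍ[ℝ]} (h : colSpace A ≤ colSpace B) :
    ∃ Z : Matrix (Fin p) (Fin n) ℍ[ℝ], A = B * Z := by
  have h1 : ∀ j, ∃ z, A.mulVec (Pi.single j 1) = B.mulVec z := fun j => h ⟨_, rfl⟩
  choose z hz using h1
  refine ⟨Matrix.of fun i j => z j i, ?_⟩
  ext1 i j
  rw [← mulVec_single_one_apply A, hz]
  rfl

instance : Module.Finite ℍ[ℝ]ᵐᵒᵖ ℍ[ℝ] :=
  ⟨⟨{1}, by
    rw [eq_top_iff]
    intro x _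
    simpa using Submodule.smul_mem _ (MulOpposite.op x)
      (Submodule.subset_span (s := ({1} : Set ℍ[ℝ])) rfl)⟩⟩

/-- Over the quaternions only the real part of the trace is cyclic; this is enough to read off ranks
of idempotents. -/
theorem re_trace_mul_comm (A : Matrix (Fin m) (Fin n) ℍ[ℝ]) (B : Matrix (Fin n) (Fin m) ℍ[ℝ]) :
    (A * B).trace.re = (B * A).trace.re := by
  simp only [Matrix.trace, Matrix.diag_apply, Matrix.mul_apply, re_sum]
  rw [Finset.sum_comm]
  simp only [re_mul_comm]

/-- An idempotent matrix of rank `r` is a product `P Q` with `Q P = 1` of order `r`. -/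
theorem exists_factorization_of_basis {E : Matrix (Fin n) (Fin n) ℍ[ℝ]} (hE : E * E = E) {r : ℕ}
    (b : Module.Basis (Fin r) ℍ[ℝ]ᵐᵒᵖ (colSpace E)) :
    ∃ (P : Matrix (Fin n) (Fin r) ℍ[ℝ]) (Q : Matrix (Fin r) (Fin n) ℍ[ℝ]),
      E = P * Q ∧ Q * P = 1 := by
  let v : Fin n → colSpace E := fun k =>
    ⟨fun i => E i k, Pi.single k 1, funext fun i => (mulVec_single_one_apply E i k).symm⟩
  let P : Matrix (Fin n) (Fin r) ℍ[ℝ] := Matrix.of fun i j => (b j : Fin n → ℍ[ℝ]) i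
  let Q : Matrix (Fin r) (Fin n) ℍ[ℝ] := Matrix.of fun j k => (b.repr (v k) j).unop
  have hPmul : ∀ c : Fin r → ℍ[ℝ], P.mulVec c =
      ((∑ j, MulOpposite.op (c j) • b j : colSpace E) : Fin n → ℍ[ℝ]) := by
    intro c
    ext1 i
    simp [Matrix.mulVec, dotProduct, P]
  have hPinj : ∀ c, P.mulVec c = 0 → c = 0 := by
    intro c hc
    rw [hPmul, Submodule.coe_eq_zero] at hc
    funext j
    have := (Fintype.linearIndependent_iff.1 b.linearIndependent) _ hc j
    simpa using this
  have hPQ : E = P * Q := by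
    ext1 i k
    have h1 : (P.mulVec fun j => Q j k) = v k := by
      rw [hPmul]
      exact congrArg Subtype.val (b.sum_repr (v k))
    exact (congrFun h1 i).symm
  have hEP : E * P = P := by
    ext1 i j
    obtain ⟨x, hx⟩ := mem_colSpace.1 (b j).2
    change (E.mulVec (b j : Fin n → ℍ[ℝ])) i = (b j : Fin n → ℍ[ℝ]) i
    rw [hx, Matrix.mulVec_mulVec, hE]
  clear_value P Q
  refine ⟨P, Q, hPQ, ?_⟩
  -- The columns of `P` form a basis, so `P` can be cancelled on the left.
  have h0 : P * (Q * P - 1) = 0 := by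
    rw [Matrix.mul_sub, ← Matrix.mul_assoc, ← hPQ, hEP, Matrix.mul_one, sub_self]
  rw [← sub_eq_zero]
  generalize Q * P - 1 = Z at h0
  ext1 i j
  exact congrFun (hPinj (fun i => Z i j) (funext fun i => congrFun (congrFun h0 i) j)) i

theorem re_trace_eq_rk {E : Matrix (Fin n) (Fin n) ℍ[ℝ]} (hE : E * E = E) :
    E.trace.re = rk E := by
  obtain ⟨P, Q, hPQ, hQP⟩ :=
    exists_factorization_of_basis hE (Module.finBasis ℍ[ℝ]ᵐᵒᵖ (colSpace E))
  calc E.trace.re = (P * Q).trace.re := by rw [← hPQ]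
    _ = rk E := by rw [re_trace_mul_comm, hQP]; simp [rk]

end LinearAlgebra

/-! ### The Moore–Penrose inverse through cofactor sums -/

section MoorePenrose

variable {n p : ℕ}

/-- The determinantal representation of the Moore-Penrose inverse of `N`
through the principal minors of `N N*`. -/
theorem isMoorePenrose_cofactorSum (N : Matrix (Fin n) (Fin p) ℍ[ℝ]) :
    minorSum (rk N) (N * N.conjTranspose) ≠ 0 ∧
      IsMoorePenrose N ((minorSum (rk N) (N * N.conjTranspose))⁻¹ •
        (N.conjTranspose * cofactorSum (rk N) (N * N.conjTranspose))) := by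
  set G := N * N.conjTranspose with hGdef
  have hG : G.IsHermitian := Matrix.isHermitian_mul_conjTranspose_self N
  obtain ⟨t, ht0, ht⟩ := exists_minorSum_ne_zero G
  set d := minorSum t G
  set C := cofactorSum t G
  set X := d⁻¹ • (N.conjTranspose * C) with hX
  set E := d⁻¹ • (G * C) with hEdef
  have hNX : N * X = E := by
    rw [hX, hEdef, Matrix.mul_smul, ← Matrix.mul_assoc]
  -- Times its own conjugate transpose this contains the factor `C_{t+1} G = G C_{t+1} = 0`. By the
  -- recursion it then says `G C_t N = d N`.
  have hCN : cofactorSum (t + 1) G * N = 0 := by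
    apply eq_zero_of_mul_conjTranspose
    rw [Matrix.conjTranspose_mul, Matrix.mul_assoc, ← Matrix.mul_assoc N, ← hGdef,
      ← Matrix.mul_assoc, ← (commute_cofactorSum hG (t + 1)).eq,
      mul_cofactorSum_succ_eq_zero hG ht, Matrix.zero_mul]
  have hEN : E * N = N := by
    rw [cofactorSum_succ hG, Matrix.sub_mul, sub_eq_zero, Matrix.smul_mul, Matrix.one_mul] at hCN
    rw [hEdef, Matrix.smul_mul, ← hCN, smul_smul, inv_mul_cancel₀ ht0, one_smul]
  have hEE : E * E = E := by
    nth_rw 2 [← hNX]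
    rw [← Matrix.mul_assoc, hEN, hNX]
  have hEherm : E.conjTranspose = E := by
    rw [hEdef, conjTranspose_real_smul, Matrix.conjTranspose_mul,
      (isHermitian_cofactorSum hG t).eq, hG.eq, (commute_cofactorSum hG t).eq]
  have hCE : C * E = E * C := by
    rw [hEdef, Matrix.mul_smul, Matrix.smul_mul, ← Matrix.mul_assoc,
      ← (commute_cofactorSum hG t).eq]
  have hNE : N.conjTranspose * E = N.conjTranspose := by
    rw [← hEherm, ← Matrix.conjTranspose_mul, hEN]
  have hrk : rk E = rk N := by
    have : colSpace E = colSpace N := by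
      apply le_antisymm
      · rw [← hNX]; exact colSpace_mul_le _ _
      · conv_lhs => rw [← hEN]
        exact colSpace_mul_le _ _
    rw [rk, rk, this]
  -- The real trace of the idempotent `E` is its rank, and it also equals `d⁻¹ (t d) = t`.
  have htr : (rk N : ℝ) = t := by
    rw [← hrk, ← re_trace_eq_rk hEE, hEdef, Matrix.trace_smul, Quaternion.re_smul,
      re_trace_mul_cofactorSum hG, smul_eq_mul, mul_comm (t : ℝ), ← mul_assoc,
      inv_mul_cancel₀ ht0, one_mul]
  rw [Nat.cast_inj] at htr
  rw [htr]
  refine ⟨ht0, ?_⟩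
  change IsMoorePenrose N X
  refine ⟨?_, ?_, ?_, ?_⟩
  · rw [hNX, hEN]
  · rw [Matrix.mul_assoc, hNX, hX, Matrix.smul_mul, Matrix.mul_assoc, hCE, ← Matrix.mul_assoc, hNE]
  · rw [hNX, hEherm]
  · rw [hX, Matrix.smul_mul, conjTranspose_real_smul, Matrix.conjTranspose_mul,
      Matrix.conjTranspose_mul, Matrix.conjTranspose_conjTranspose,
      (isHermitian_cofactorSum hG t).eq, Matrix.mul_assoc]

end MoorePenrose

/-! ### Powers beyond the index and orthogonal projectors -/

section Index

variable {m n p : ℕ}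

theorem colSpace_pow_succ_le (M : Matrix (Fin n) (Fin n) ℍ[ℝ]) (k : ℕ) :
    colSpace (M ^ (k + 1)) ≤ colSpace (M ^ k) := by
  rw [pow_succ]
  exact colSpace_mul_le _ _

theorem rk_pow_succ_le (M : Matrix (Fin n) (Fin n) ℍ[ℝ]) (k : ℕ) :
    rk (M ^ (k + 1)) ≤ rk (M ^ k) :=
  Submodule.finrank_mono (colSpace_pow_succ_le M k)

theorem rk_pow_ind (M : Matrix (Fin n) (Fin n) ℍ[ℝ]) : rk (M ^ (ind M + 1)) = rk (M ^ ind M) := by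
  have hne : {k : ℕ | 0 < k ∧ rk (M ^ (k + 1)) = rk (M ^ k)}.Nonempty := by
    by_contra hemp
    have hlt : ∀ k, rk (M ^ (k + 1 + 1)) < rk (M ^ (k + 1)) := fun k =>
      lt_of_le_of_ne (rk_pow_succ_le M (k + 1)) fun h => hemp ⟨k + 1, k.succ_pos, h⟩
    have hb : ∀ k, rk (M ^ (k + 1)) + k ≤ rk (M ^ 1) := by
      intro k
      induction k with
      | zero => simp
      | succ k ih => have := hlt k; omega
    have := hb (rk (M ^ 1) + 1)
    omega
  exact (Nat.sInf_mem hne).2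

/-- Beyond the index the powers of a matrix have the same column space. -/
theorem exists_pow_eq_pow_succ_mul (M : Matrix (Fin n) (Fin n) ℍ[ℝ]) {k : ℕ} (hk : ind M ≤ k) :
    ∃ Z : Matrix (Fin n) (Fin n) ℍ[ℝ], M ^ k = M ^ (k + 1) * Z := by
  have h1 : colSpace (M ^ (ind M + 1)) = colSpace (M ^ ind M) :=
    Submodule.eq_of_le_of_finrank_eq (colSpace_pow_succ_le M _) (rk_pow_ind M)
  obtain ⟨Z, hZ⟩ := exists_eq_mul_of_colSpace_le h1.ge
  refine ⟨Z, ?_⟩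
  obtain ⟨j, rfl⟩ := Nat.exists_eq_add_of_le' hk
  rw [pow_add, add_assoc, pow_add, Matrix.mul_assoc, ← hZ]

/-- Beyond the index, `M` maps the column space of `M ^ k` onto itself, hence injectively by finite
dimension. -/
theorem mulVec_eq_zero_of_mem_colSpace {M : Matrix (Fin n) (Fin n) ℍ[ℝ]} {k : ℕ}
    (hk : ind M ≤ k) {y : Fin n → ℍ[ℝ]} (hy : y ∈ colSpace (M ^ k)) (h : M.mulVec y = 0) :
    y = 0 := by
  let L : colSpace (M ^ k) →ₗ[ℍ[ℝ]ᵐᵒᵖ] colSpace (M ^ k) :=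
    { toFun := fun v => ⟨M.mulVec v, by
        obtain ⟨x, hx⟩ := mem_colSpace.1 v.2
        refine ⟨M.mulVec x, ?_⟩
        rw [hx, Matrix.mulVec_mulVec, Matrix.mulVec_mulVec, ← pow_succ, ← pow_succ']⟩
      map_add' := fun v w => Subtype.ext (Matrix.mulVec_add M v w)
      map_smul' := fun c v => Subtype.ext (Matrix.mulVec_smul M c v) }
  have hL : ∀ v, (L v : Fin n → ℍ[ℝ]) = M.mulVec v := fun _ => rfl
  have hsurj : Function.Surjective L := by
    rintro ⟨v, x, rfl⟩
    obtain ⟨Z, hZ⟩ := exists_pow_eq_pow_succ_mul M hk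
    refine ⟨⟨(M ^ k).mulVec (Z.mulVec x), ⟨_, rfl⟩⟩, Subtype.ext ?_⟩
    rw [hL]
    change M.mulVec ((M ^ k).mulVec (Z.mulVec x)) = (M ^ k).mulVec x
    rw [Matrix.mulVec_mulVec, Matrix.mulVec_mulVec, ← pow_succ', ← hZ]
  have hinj := LinearMap.injective_iff_surjective.2 hsurj
  have : (⟨y, hy⟩ : colSpace (M ^ k)) = 0 := by
    apply hinj
    rw [map_zero]
    exact Subtype.ext h
  exact congrArg Subtype.val this

theorem eq_zero_of_colSpace_le {M : Matrix (Fin n) (Fin n) ℍ[ℝ]} {k : ℕ} (hk : ind M ≤ k)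
    {Y : Matrix (Fin n) (Fin p) ℍ[ℝ]} (hY : colSpace Y ≤ colSpace (M ^ k)) (h : M * Y = 0) :
    Y = 0 := by
  ext1 i j
  rw [← mulVec_single_one_apply Y, mulVec_eq_zero_of_mem_colSpace hk (hY ⟨Pi.single j 1, rfl⟩)]
  · rfl
  · rw [Matrix.mulVec_mulVec, h, Matrix.zero_mulVec]

/-- `N * P` is the orthogonal projector onto the column space of `N`. Two Hermitian projectors with
the same range fix each other, and taking adjoints identifies them. -/
theorem mul_eq_mul_of_isMoorePenrose {N : Matrix (Fin n) (Fin m) ℍ[ℝ]}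
    {N' : Matrix (Fin n) (Fin p) ℍ[ℝ]} {P : Matrix (Fin m) (Fin n) ℍ[ℝ]}
    {P' : Matrix (Fin p) (Fin n) ℍ[ℝ]} (hP : IsMoorePenrose N P) (hP' : IsMoorePenrose N' P')
    (h : colSpace N = colSpace N') : N * P = N' * P' := by
  obtain ⟨Z, hZ⟩ := exists_eq_mul_of_colSpace_le h.le
  obtain ⟨Z', hZ'⟩ := exists_eq_mul_of_colSpace_le h.ge
  have h1 : N' * P' * (N * P) = N * P := by
    rw [← Matrix.mul_assoc, show N' * P' * N = N by
      conv_lhs => rw [hZ, ← Matrix.mul_assoc, hP'.mul_mul_self, ← hZ]]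
  have h2 : N * P * (N' * P') = N' * P' := by
    rw [← Matrix.mul_assoc, show N * P * N' = N' by
      conv_lhs => rw [hZ', ← Matrix.mul_assoc, hP.mul_mul_self, ← hZ']]
  rw [← hP.left_herm, ← h1, Matrix.conjTranspose_mul, hP.left_herm, hP'.left_herm, h2]

end Index

/-! ### The weighted core-EP inverse -/

section CoreEP

variable {m n : ℕ}

theorem mul_pow_comm (A : Matrix (Fin m) (Fin n) ℍ[ℝ]) (W : Matrix (Fin n) (Fin m) ℍ[ℝ]) (k : ℕ) :
    A * (W * A) ^ k = (A * W) ^ k * A := by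
  induction k with
  | zero => simp
  | succ k ih => rw [pow_succ, ← Matrix.mul_assoc, ih, pow_succ]; simp only [Matrix.mul_assoc]

/-- The difference of two solutions is killed by `(A W)²`, while `A W` is injective on the column
space of `(A W)^k`, which contains it. -/
theorem isRightWeightedCoreEP_unique {A : Matrix (Fin m) (Fin n) ℍ[ℝ]}
    {W : Matrix (Fin n) (Fin m) ℍ[ℝ]} {X Y : Matrix (Fin m) (Fin n) ℍ[ℝ]}
    (hX : IsRightWeightedCoreEP A W X) (hY : IsRightWeightedCoreEP A W Y) : X = Y := by
  obtain ⟨⟨P, hP, hXP⟩, hXc⟩ := hX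
  obtain ⟨⟨Q, hQ, hYQ⟩, hYc⟩ := hY
  set k := max (ind (W * A)) (ind (A * W))
  have hk : ind (A * W) ≤ k := le_max_right _ _
  have h0 : W * A * W * (X - Y) = 0 := by
    rw [Matrix.mul_sub, hXP, hYQ, mul_eq_mul_of_isMoorePenrose hP hQ rfl, sub_self]
  have hc : colSpace (X - Y) ≤ colSpace ((A * W) ^ k) := by
    obtain ⟨Z, hZ⟩ := exists_eq_mul_of_colSpace_le hXc
    obtain ⟨Z', hZ'⟩ := exists_eq_mul_of_colSpace_le hYc
    rw [hZ, hZ', ← Matrix.mul_sub]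
    exact colSpace_mul_le _ _
  have hc' : colSpace (A * W * (X - Y)) ≤ colSpace ((A * W) ^ k) := by
    obtain ⟨Z, hZ⟩ := exists_eq_mul_of_colSpace_le hc
    rw [hZ, ← Matrix.mul_assoc, ← pow_succ', pow_succ, Matrix.mul_assoc]
    exact colSpace_mul_le _ _
  have h1 : A * W * (A * W * (X - Y)) = 0 := by
    have : A * W * (A * W * (X - Y)) = A * (W * A * W * (X - Y)) := by
      simp only [Matrix.mul_assoc]
    rw [this, h0, Matrix.mul_zero]
  exact sub_eq_zero.1 (eq_zero_of_colSpace_le hk hc (eq_zero_of_colSpace_le hk hc' h1))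

/-- The right weighted core-EP inverse in terms of a Moore-Penrose inverse of `(W A)^(k+1)`. -/
theorem isRightWeightedCoreEP_of_isMoorePenrose {A : Matrix (Fin m) (Fin n) ℍ[ℝ]}
    {W : Matrix (Fin n) (Fin m) ℍ[ℝ]} {k : ℕ} (hk : k = max (ind (W * A)) (ind (A * W)))
    {T : Matrix (Fin n) (Fin n) ℍ[ℝ]} (hT : IsMoorePenrose ((W * A) ^ (k + 1)) T) :
    IsRightWeightedCoreEP A W (A * (W * A) ^ k * T * (W * A) ^ k * T) := by
  have hkU : ind (W * A) ≤ k := hk ▸ le_max_left _ _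
  obtain ⟨Z, hZ⟩ := exists_pow_eq_pow_succ_mul (W * A) hkU
  have hcol : colSpace ((W * A) ^ k) = colSpace ((W * A) ^ (k + 1)) :=
    le_antisymm (by conv_lhs => rw [hZ]
                    exact colSpace_mul_le _ _) (colSpace_pow_succ_le _ _)
  rw [IsRightWeightedCoreEP, ← hk]
  refine ⟨⟨_, (isMoorePenrose_cofactorSum ((W * A) ^ k)).2, ?_⟩, ?_⟩
  · rw [mul_eq_mul_of_isMoorePenrose (isMoorePenrose_cofactorSum ((W * A) ^ k)).2 hT hcol]
    -- `(W A)^(k+1) T` projects onto the column space of `(W A)^(k+1)`, which already contains that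
    -- of `(W A)^k`.
    have h1 : (W * A) ^ (k + 1) * T * (W * A) ^ k = (W * A) ^ k := by
      conv_lhs => rw [hZ, ← Matrix.mul_assoc, hT.mul_mul_self, ← hZ]
    calc W * A * W * (A * (W * A) ^ k * T * (W * A) ^ k * T)
        = W * A * (((W * A) * (W * A) ^ k) * T * (W * A) ^ k) * T := by
          simp only [Matrix.mul_assoc]
      _ = (W * A) ^ (k + 1) * T := by rw [← pow_succ', h1, ← pow_succ']
  · rw [mul_pow_comm]
    simp only [Matrix.mul_assoc]
    exact colSpace_mul_le _ _

end CoreEP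

end QuaternionMatrix

/-! ### The determinantal representation -/

theorem theorem3p5 {m n : ℕ} (A : Matrix (Fin m) (Fin n) ℍ[ℝ]) (W : Matrix (Fin n) (Fin m) ℍ[ℝ])
    (k s : ℕ) (hk : k = max (QuaternionMatrix.ind (W * A)) (QuaternionMatrix.ind (A * W)))
    (hs : s = QuaternionMatrix.rk ((W * A) ^ k))
    (U : Matrix (Fin n) (Fin n) ℍ[ℝ]) (hU : U = W * A)
    (G : Matrix (Fin n) (Fin n) ℍ[ℝ]) (hG : G = U ^ (k + 1) * (U ^ (k + 1)).conjTranspose)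
    (Utilde : Matrix (Fin m) (Fin n) ℍ[ℝ])
    (hUtilde : Utilde = A * U ^ k * (U ^ (k + 1)).conjTranspose)
    (Φ : Matrix (Fin m) (Fin n) ℍ[ℝ])
    (hΦ : ∀ i f, Φ i f = QuaternionMatrix.sumRdet s G f (Utilde i))
    (Φtilde : Matrix (Fin m) (Fin n) ℍ[ℝ])
    (hΦtilde : Φtilde = Φ * U ^ k * (U ^ (k + 1)).conjTranspose) :
    (∃! X, QuaternionMatrix.IsRightWeightedCoreEP A W X) ∧
    QuaternionMatrix.sumMinors s G ≠ 0 ∧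
    ∀ X, QuaternionMatrix.IsRightWeightedCoreEP A W X →
      ∀ i j, X i j =
        QuaternionMatrix.sumRdet s G j (Φtilde i) / (QuaternionMatrix.sumMinors s G) ^ 2 := by
  open QuaternionMatrix in
  subst hU
  -- The order of the minors must be the rank of `(W A)^(k+1)`; since `k` is at least the index, it
  -- is also that of `(W A)^k`.
  have hs' : rk ((W * A) ^ (k + 1)) = s := by
    obtain ⟨Z, hZ⟩ := exists_pow_eq_pow_succ_mul (W * A) (hk ▸ le_max_left _ _ : ind (W * A) ≤ k)
    rw [hs]
    refine le_antisymm (rk_pow_succ_le _ _) (Submodule.finrank_mono ?_)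
    conv_lhs => rw [hZ]
    exact colSpace_mul_le _ _
  obtain ⟨hd, hT⟩ := isMoorePenrose_cofactorSum ((W * A) ^ (k + 1))
  rw [hs', ← hG] at hd hT
  have hGH : G.IsHermitian := by
    rw [hG]
    exact Matrix.isHermitian_mul_conjTranspose_self _
  set N := (W * A) ^ (k + 1)
  set d := minorSum s G
  set T := d⁻¹ • (N.conjTranspose * cofactorSum s G) with hTdef
  have hX := isRightWeightedCoreEP_of_isMoorePenrose hk hT
  have hNC : N.conjTranspose * cofactorSum s G = d • T := by
    rw [hTdef, smul_smul, mul_inv_cancel₀ hd, one_smul]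
  have hΦ' : Φ = d • (A * (W * A) ^ k * T) := by
    have : Φ = Utilde * cofactorSum s G := by
      ext1 i f
      rw [hΦ, mul_cofactorSum_apply]
    rw [this, hUtilde, Matrix.mul_assoc, hNC, Matrix.mul_smul]
  have hfinal : Φtilde * cofactorSum s G =
      (d * d) • (A * (W * A) ^ k * T * (W * A) ^ k * T) := by
    rw [hΦtilde, Matrix.mul_assoc, hNC, Matrix.mul_smul, hΦ', Matrix.smul_mul, Matrix.smul_mul,
      smul_smul]
  have hdq : sumMinors s G ≠ 0 := by
    rw [sumMinors_eq_coe hGH]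
    exact fun h => hd (Quaternion.coe_injective h)
  refine ⟨⟨_, hX, fun Y hY => isRightWeightedCoreEP_unique hY hX⟩, hdq, fun X hX' i j => ?_⟩
  -- The denominator is the real number `d` squared, so after clearing it quaternionic
  -- multiplication is real scaling and `hfinal` applies.
  rw [isRightWeightedCoreEP_unique hX' hX, eq_div_iff (pow_ne_zero 2 hdq),
    ← mul_cofactorSum_apply, hfinal, sumMinors_eq_coe hGH, ← Quaternion.coe_pow,
    Quaternion.mul_coe_eq_smul, sq, Matrix.smul_apply]
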